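/- Let $S=\bar S\smallsetminus R$, where $\bar S$ is a connected compact oriented surface of genus $g$ with $k\ge 1$ boundary components and $R\subset\partial\bar S$ is a finite set of $r$ points, $4g-4+2k+r>0$. Let $\mathcal T$ be an ideal triangulation of $S$ (one vertex on each component of $\partial S$), and let $n$ be a natural number. The quiver $\Gamma_{\mathcal T}$ has one vertex near each side of each triangle ($V$ is the set of vertices); its arrows are the set $A_3$ of the arrows that form, in each triangle, a clockwise $3$-cycle through its three vertices, and the set $A_2$ of the arrows that form, across each internal edge, a $2$-cycle between the two adjacent vertices. An arrow $a$ goes from $v^-(a)$ to $v^+(a)$. A framed twisted $\mathrm{Sp}(2n,\mathbf R)$-local system on $\Gamma_{\mathcal T}$ consists of symplectic isomorphisms $g_a\colon F_{v^-(a)}\to F_{v^+(a)}$ between symplectic vector spaces $F_v$ of dimension $2n$, whose product along each $2$-cycle of $A_2$ and along each $3$-cycle of $A_3$ is $-\mathrm{Id}$, and of Lagrangians $L^t_v,L^b_v\subset F_v$ with $g_a(L^t_{v^-(a)})=L^b_{v^+(a)}$ and $g_a(L^b_{v^-(a)})=L^t_{v^+(a)}$ for $a\in A_2$, and $g_a(L^b_{v^-(a)})=L^t_{v^+(a)}$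 for $a\in A_3$. The moduli space of their equivalence classes carries the quotient topology. Such a system corresponds to a framed twisted local system on $S$; it is called maximal if there is an ideal triangulation of $S$ such that, for each of its triangles, the triple of Lagrangians at the vertices (in counterclockwise order) has Maslov index $n$. Let $\mathcal M^f_\delta(\Gamma_{\mathcal T},\mathrm{Sp}(2n,\mathbf R))$ be the space of equivalence classes of maximal ones. Let $\Delta_n$ be the set of diagonal $n\times n$ matrices with positive nondecreasing diagonal entries, and let $\mathcal X^+_\Delta(\mathcal T,n)$ be the space of the families $x=(x(a))_{a\in A_2\sqcup A_3}$ with $x(a)\in\Delta_n$ for $a\in A_2$ and $x(a)\in \mathrm O(n)$ for $a\in A_3$, such that $x(a)=x(a')$ for each $2$-cycle $(a,a')$ in $A_2$ and $x(a_3)x(a_2)x(a_1)=\mathrm{Id}$ for each $3$-cycle $(a_1,a_2,a_3)$ in $A_3$. Let $\mathrm{hol}(x)$ be the class of the system with $F_v=\mathbf R^{2n}$, $L^t_v=\mathrm{Span}(e_1,\dots,e_n)$, $L^b_v=\mathrm{Span}(f_1,\dots,f_n)$ for the standard symplectic basis $(e_1,\dots,e_n,f_1,\dots,f_n)$, and with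 transition matrices $$\begin{pmatrix}0&-x(a)^{-1/2}\\ x(a)^{1/2}&0\end{pmatrix}\ (a\in A_2),\qquad \begin{pmatrix}x(a)&-x(a)\\ x(a)&0\end{pmatrix}\ (a\in A_3).$$ Then $\mathrm{hol}$ takes its values in $\mathcal M^f_\delta(\Gamma_{\mathcal T},\mathrm{Sp}(2n,\mathbf R))$, and: 1. The map $\mathrm{hol}\colon \mathcal X^+_\Delta(\mathcal T,n)\to\mathcal M^f_\delta(\Gamma_{\mathcal T},\mathrm{Sp}(2n,\mathbf R))$ is surjective. 2. For $x,x'\in\mathcal X^+_\Delta(\mathcal T,n)$, one has $\mathrm{hol}(x)=\mathrm{hol}(x')$ if and only if $x(a)=x'(a)$ for every $a\in A_2$ and there is a family $(r_v)_{v\in V}$ of orthogonal matrices such that, for all $a\in A_2$, $r_{v^-(a)}=r_{v^+(a)}$ and this matrix commutes with $x(a)$, and, for all $a\in A_3$, $x'(a)=r_{v^+(a)}\,x(a)\,r_{v^-(a)}^{-1}$. 3. The map $\mathrm{hol}\colon \mathcal X^+_\Delta(\mathcal T,n)\to\mathcal M^f_\delta(\Gamma_{\mathcal T},\mathrm{Sp}(2n,\mathbf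 R))$ is proper. 4. If $R=\emptyset$, this map is generically finite-to-one: there is a dense open subset of $\mathcal M^f_\delta(\Gamma_{\mathcal T},\mathrm{Sp}(2n,\mathbf R))$, with dense preimage in $\mathcal X^+_\Delta(\mathcal T,n)$, over each point of which the fibre is finite. -/

import Mathlib

noncomputable section

open scoped MatrixOrder

namespace FramedSp

/-! ### Symplectic linear algebra -/

/-- The space `ℝ²ⁿ`, with coordinates `inl i` along `eᵢ` and `inr i` along `fᵢ`. -/
abbrev E (n : ℕ) : Type := Fin n ⊕ Fin n → ℝ

/-- The symplectic group `Sp(2n, ℝ)`. -/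
abbrev Sp (n : ℕ) : Type := Matrix.symplecticGroup (Fin n) ℝ

/-- The orthogonal group `O(n)`. -/
abbrev On (n : ℕ) : Type := Matrix.orthogonalGroup (Fin n) ℝ

/-- The standard symplectic form, `ω(eᵢ, fⱼ) = δᵢⱼ`. -/
def omega (n : ℕ) : LinearMap.BilinForm ℝ (E n) :=
  Matrix.toBilin' (Matrix.fromBlocks 0 1 (-1) 0)

/-- Lagrangian subspaces of `ℝ²ⁿ`. -/
def IsLagrangian {n : ℕ} (L : Submodule ℝ (E n)) : Prop :=
  Module.finrank ℝ L = n ∧ ∀ x ∈ L, ∀ y ∈ L, omega n x y = 0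

/-- The Lagrangian Grassmannian. -/
def Lag (n : ℕ) : Type := {L : Submodule ℝ (E n) // IsLagrangian L}

theorem Lag.ext {n : ℕ} {L M : Lag n} (h : L.1 = M.1) : L = M := Subtype.ext h

theorem Lag.eq_of_le {n : ℕ} {L M : Lag n} (h : L.1 ≤ M.1) : L = M :=
  Lag.ext (Submodule.eq_of_le_of_finrank_eq h (L.2.1.trans M.2.1.symm))

theorem omega_eq (n : ℕ) (x y : E n) :
    omega n x y = -(x ⬝ᵥ (Matrix.J (Fin n) ℝ).mulVec y) := by
  have : (Matrix.fromBlocks 0 1 (-1) 0 : Matrix (Fin n ⊕ Fin n) (Fin n ⊕ Fin n) ℝ)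
      = -Matrix.J (Fin n) ℝ := by
    simp [Matrix.J, Matrix.fromBlocks_neg]
  rw [omega, this, Matrix.toBilin'_apply', Matrix.neg_mulVec, dotProduct_neg]

theorem omega_mulVec {n : ℕ} (g : Sp n) (x y : E n) :
    omega n (g.1.mulVec x) (g.1.mulVec y) = omega n x y := by
  rw [omega_eq, omega_eq, Matrix.mulVec_mulVec, Matrix.dotProduct_mulVec,
    ← Matrix.vecMul_transpose, Matrix.vecMul_vecMul, ← Matrix.dotProduct_mulVec,
    ← Matrix.mul_assoc, SymplecticGroup.mem_iff'.1 g.2]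

theorem mulVec_injective {n : ℕ} (g : Sp n) : Function.Injective g.1.mulVecLin := by
  intro x y h
  have h2 := congrArg (g⁻¹ : Sp n).1.mulVec h
  simp only [Matrix.mulVecLin_apply, Matrix.mulVec_mulVec] at h2
  have h3 : (g⁻¹ : Sp n).1 * g.1 = 1 := congrArg Subtype.val (inv_mul_cancel g)
  simpa [h3] using h2

/-- `Sp(2n, ℝ)` acts on Lagrangians by taking images. -/
instance (n : ℕ) : MulAction (Sp n) (Lag n) where
  smul g L := ⟨L.1.map g.1.mulVecLin, by
    refine ⟨?_, ?_⟩
    · exact (Submodule.equivMapOfInjective _ (mulVec_injective g) L.1).finrank_eq.symm.trans L.2.1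
    · rintro _ ⟨x, hx, rfl⟩ _ ⟨y, hy, rfl⟩
      exact (omega_mulVec g x y).trans (L.2.2 x hx y hy)⟩
  one_smul L := Lag.ext (by
    change L.1.map (1 : Matrix _ _ ℝ).mulVecLin = L.1
    simp)
  mul_smul g h L := Lag.ext (by
    change L.1.map (g.1 * h.1).mulVecLin = (L.1.map h.1.mulVecLin).map g.1.mulVecLin
    rw [Matrix.mulVecLin_mul, Submodule.map_comp])

/-- `Sp(2n, ℝ)` acts on Lagrangians: membership in `g • L`. -/
theorem mem_smul_lag {n : ℕ} (g : Sp n) (L : Lag n) (y : E n) :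
    y ∈ (g • L).1 ↔ ∃ x ∈ L.1, g.1.mulVec x = y := Iff.rfl

theorem isLagrangian_span {n : ℕ} {j : Fin n → Fin n ⊕ Fin n} (hj : Function.Injective j)
    (h : ∀ i k, omega n (Pi.single (j i) 1) (Pi.single (j k) 1) = 0) :
    IsLagrangian (Submodule.span ℝ (Set.range fun i => (Pi.single (j i) 1 : E n))) := by
  constructor
  · have hli : LinearIndependent ℝ (fun i => (Pi.single (j i) 1 : E n)) := by
      have := (Pi.basisFun ℝ (Fin n ⊕ Fin n)).linearIndependent.comp j hj
      simpa [Function.comp_def] using this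
    simpa using finrank_span_eq_card hli
  · intro x hx y hy
    induction hx, hy using Submodule.span_induction₂ with
    | mem_mem x y hx hy =>
      obtain ⟨i, rfl⟩ := hx
      obtain ⟨k, rfl⟩ := hy
      exact h i k
    | zero_left y hy => simp
    | zero_right x hx => simp
    | add_left x y z _ _ _ h1 h2 => simp [h1, h2]
    | add_right x y z _ _ _ h1 h2 => simp [h1, h2]
    | smul_left r x y _ _ h1 => simp [h1]
    | smul_right r x y _ _ h1 => simp [h1]

/-- `Span(e₁, …, eₙ)`. -/
def spanE (n : ℕ) : Lag n :=
  ⟨Submodule.span ℝ (Set.range fun i => (Pi.single (Sum.inl i) 1 : E n)),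
    isLagrangian_span Sum.inl_injective fun i k => by
      simp [omega, Matrix.toBilin'_single]⟩

/-- `Span(f₁, …, fₙ)`. -/
def spanF (n : ℕ) : Lag n :=
  ⟨Submodule.span ℝ (Set.range fun i => (Pi.single (Sum.inr i) 1 : E n)),
    isLagrangian_span Sum.inr_injective fun i k => by
      simp [omega, Matrix.toBilin'_single]⟩

theorem mem_spanE {n : ℕ} {x : E n} : x ∈ (spanE n).1 ↔ ∀ i, x (Sum.inr i) = 0 := by
  constructor
  · intro hx i
    induction hx using Submodule.span_induction with
    | mem y hy => obtain ⟨k, rfl⟩ := hy; simp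
    | zero => rfl
    | add y z _ _ h1 h2 => simp [h1, h2]
    | smul r y _ h1 => simp [h1]
  · intro hx
    have : x = ∑ i, x (Sum.inl i) • (Pi.single (Sum.inl i) 1 : E n) := by
      ext (k | k)
      · simp [Finset.sum_apply, Pi.single_apply]
      · simp [Finset.sum_apply, hx]
    rw [this]
    exact Submodule.sum_mem _ fun i _ => Submodule.smul_mem _ _ (Submodule.subset_span ⟨i, rfl⟩)

theorem mem_spanF {n : ℕ} {x : E n} : x ∈ (spanF n).1 ↔ ∀ i, x (Sum.inl i) = 0 := by
  constructor
  · intro hx i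
    induction hx using Submodule.span_induction with
    | mem y hy => obtain ⟨k, rfl⟩ := hy; simp
    | zero => rfl
    | add y z _ _ h1 h2 => simp [h1, h2]
    | smul r y _ h1 => simp [h1]
  · intro hx
    have : x = ∑ i, x (Sum.inr i) • (Pi.single (Sum.inr i) 1 : E n) := by
      ext (k | k)
      · simp [Finset.sum_apply, hx]
      · simp [Finset.sum_apply, Pi.single_apply]
    rw [this]
    exact Submodule.sum_mem _ fun i _ => Submodule.smul_mem _ _ (Submodule.subset_span ⟨i, rfl⟩)

/-- The topology of the Lagrangian Grassmannian as the homogeneous space `Sp(2n, ℝ) / P`, where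
`P` is the stabilizer of `Span(e)`. -/
instance (n : ℕ) : TopologicalSpace (Lag n) :=
  TopologicalSpace.coinduced (fun g : Sp n => g • spanE n) inferInstance

/-- The quadratic form `(v, w, x) ↦ ω(v, w) + ω(w, x) + ω(x, v)` on `L₁ ⊕ M ⊕ L₂`. -/
def maslovForm {n : ℕ} (L₁ M L₂ : Lag n) : QuadraticForm ℝ (L₁.1 × M.1 × L₂.1) :=
  let p₁ := L₁.1.subtype ∘ₗ LinearMap.fst ℝ L₁.1 (M.1 × L₂.1)
  let p₂ := M.1.subtype ∘ₗ LinearMap.fst ℝ M.1 L₂.1 ∘ₗ LinearMap.snd ℝ L₁.1 (M.1 × L₂.1)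
  let p₃ := L₂.1.subtype ∘ₗ LinearMap.snd ℝ M.1 L₂.1 ∘ₗ LinearMap.snd ℝ L₁.1 (M.1 × L₂.1)
  LinearMap.BilinMap.toQuadraticMap
    ((omega n).compl₁₂ p₁ p₂ + (omega n).compl₁₂ p₂ p₃ + (omega n).compl₁₂ p₃ p₁)

/-- The Maslov index of a triple of Lagrangians: the signature of `maslovForm`. -/
def maslovIndex {n : ℕ} (L₁ M L₂ : Lag n) : ℤ :=
  (sigPos (maslovForm L₁ M L₂) : ℤ) - sigNeg (maslovForm L₁ M L₂)

/-! ### Ideal triangulations and their quivers -/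

/-- An ideal triangulation of a connected oriented surface, presented by gluing oriented triangles
along sides. `V` is the set of sides of the triangles (pairs of a face and one of its three edges).
`next` goes clockwise to the following side of the same face, so that the faces are the orbits of
`next`; `opp` sends a side of a face to the side it is glued to (by the orientation reversing
identification), and fixes the sides that are not glued, that is, the external edges.
The orbits of corners of the triangles are the vertices of the triangulation, that is, the
components of the boundary of the surface. -/
structure IdealTriangulation (V : Type*) where
  next : Equiv.Perm V
  opp : Equiv.Perm V
  next_next_next : ∀ v, next (next (next v)) = v
  next_ne : ∀ v, next v ≠ v
  opp_opp : ∀ v, opp (opp v) = v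
  connected : ∀ v w, ∃ g ∈ Subgroup.closure {next, opp}, g v = w

namespace IdealTriangulation

variable {V : Type*}

/-- The quiver of the triangulation has vertex set `V` (one vertex near each side of each face).
`A₂` is the set of its arrows crossing an internal edge: one arrow `v → opp v` for every side `v`
with `opp v ≠ v`. The arrows inside the faces are the arrows `v → next v`, one for every `v`; their
set `A₃` is identified with `V` by taking start points. -/
abbrev A₂ (T : IdealTriangulation V) : Type _ := {v : V // T.opp v ≠ v}

/-- Start point of an arrow in `A₂`. -/
def src {T : IdealTriangulation V} (a : T.A₂) : V := a.1

/-- End point of an arrow in `A₂`. -/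
def tgt {T : IdealTriangulation V} (a : T.A₂) : V := T.opp a.1

/-- The other arrow of the `2`-cycle containing an arrow of `A₂`. -/
def rev {T : IdealTriangulation V} (a : T.A₂) : T.A₂ :=
  ⟨T.opp a.1, fun h => a.2 (by rw [T.opp_opp] at h; exact h.symm)⟩

/-- `T'` is obtained from `T` by flipping the internal edge with sides `v` and `w = opp v`, which
belong to two different faces. The faces `(v, a, b)` and `(w, c, d)` (sides listed clockwise) form
a quadrilateral with sides `a, b, c, d` (listed clockwise); they are replaced with the faces
`(v, b, c)` and `(w, d, a)`, where `v` and `w` now are the two sides of the other diagonal. -/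
structure IsFlip (T T' : IdealTriangulation V) (v : V) : Prop where
  internal : T.opp v ≠ v
  ne_next : T.opp v ≠ T.next v
  ne_next_next : T.opp v ≠ T.next (T.next v)
  opp_eq : T'.opp = T.opp
  next_v : T'.next v = T.next (T.next v)
  next_b : T'.next (T.next (T.next v)) = T.next (T.opp v)
  next_c : T'.next (T.next (T.opp v)) = v
  next_w : T'.next (T.opp v) = T.next (T.next (T.opp v))
  next_d : T'.next (T.next (T.next (T.opp v))) = T.next v
  next_a : T'.next (T.next v) = T.opp v
  next_other : ∀ u, u ≠ v → u ≠ T.next v → u ≠ T.next (T.next v) →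
    u ≠ T.opp v → u ≠ T.next (T.opp v) → u ≠ T.next (T.next (T.opp v)) → T'.next u = T.next u

theorem IsFlip.internal' {T T' : IdealTriangulation V} {v : V} (h : IsFlip T T' v) :
    T'.opp v ≠ v := by rw [h.opp_eq]; exact h.internal

end IdealTriangulation

open IdealTriangulation

variable {V : Type*}

/-! ### Framed twisted symplectic local systems on the quiver -/

/-- A framed `δ`-twisted `Sp(2n, ℝ)`-local system on the quiver of `T`, with all the fibres
identified with the standard symplectic space `ℝ²ⁿ`. -/
@[ext]
structure FramedLocalSystem (T : IdealTriangulation V) (n : ℕ) where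
  /-- transition map of an arrow in `A₂` -/
  edge : T.A₂ → Sp n
  /-- transition map of the arrow `v → next v` in `A₃` -/
  tri : V → Sp n
  /-- the Lagrangians `Lᵗ` -/
  Lt : V → Lag n
  /-- the Lagrangians `Lᵇ` -/
  Lb : V → Lag n
  edge_twisted : ∀ a : T.A₂, (edge (rev a)).1 * (edge a).1 = -1
  tri_twisted : ∀ v, (tri (T.next (T.next v))).1 * (tri (T.next v)).1 * (tri v).1 = -1
  edge_Lt : ∀ a : T.A₂, edge a • Lt (src a) = Lb (tgt a)
  edge_Lb : ∀ a : T.A₂, edge a • Lb (src a) = Lt (tgt a)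
  tri_Lb : ∀ v, tri v • Lb v = Lt (T.next v)

namespace FramedLocalSystem

variable {T T' : IdealTriangulation V} {n : ℕ}

/-- Equivalence of framed local systems. -/
def Equivalent (F F' : FramedLocalSystem T n) : Prop :=
  ∃ ψ : V → Sp n,
    (∀ a : T.A₂, F'.edge a * ψ (src a) = ψ (tgt a) * F.edge a) ∧
    (∀ v, F'.tri v * ψ v = ψ (T.next v) * F.tri v) ∧
    (∀ v, ψ v • F.Lt v = F'.Lt v) ∧
    (∀ v, ψ v • F.Lb v = F'.Lb v)

instance setoid (T : IdealTriangulation V) (n : ℕ) : Setoid (FramedLocalSystem T n) where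
  r := Equivalent
  iseqv :=
    { refl := fun F => ⟨fun _ => 1, by simp, by simp, by simp, by simp⟩
      symm := by
        rintro F F' ⟨ψ, h1, h2, h3, h4⟩
        refine ⟨fun v => (ψ v)⁻¹, fun a => ?_, fun v => ?_, fun v => ?_, fun v => ?_⟩
        · rw [eq_inv_mul_iff_mul_eq, ← mul_assoc, ← h1 a, mul_inv_cancel_right]
        · rw [eq_inv_mul_iff_mul_eq, ← mul_assoc, ← h2 v, mul_inv_cancel_right]
        · rw [← h3 v, inv_smul_smul]
        · rw [← h4 v, inv_smul_smul]
      trans := by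
        rintro F F' F'' ⟨ψ, h1, h2, h3, h4⟩ ⟨φ, k1, k2, k3, k4⟩
        refine ⟨fun v => φ v * ψ v, fun a => ?_, fun v => ?_, fun v => ?_, fun v => ?_⟩
        · rw [← mul_assoc, k1 a, mul_assoc, h1 a, mul_assoc]
        · rw [← mul_assoc, k2 v, mul_assoc, h2 v, mul_assoc]
        · rw [mul_smul, h3 v, k3 v]
        · rw [mul_smul, h4 v, k4 v] }

/-- The topology on framed local systems as tuples of matrices and Lagrangians. -/
instance (T : IdealTriangulation V) (n : ℕ) : TopologicalSpace (FramedLocalSystem T n) :=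
  TopologicalSpace.induced (fun F => (F.edge, F.tri, F.Lt, F.Lb)) inferInstance

/-- For every triangle of `T`, the Maslov index of the triple of Lagrangians at its vertices,
in counterclockwise order, is `n`. The triple is seen from the endpoint of each of the three arrows
contained in the triangle. -/
def AllMaslovMaximal (F : FramedLocalSystem T n) : Prop :=
  ∀ v, maslovIndex (F.Lt (T.next v)) (F.tri v • F.Lt v) (F.Lb (T.next v)) = n

/-- `F` on `T` and `F'` on the flipped triangulation `T'` are the restrictions to the two quivers of
the same framed twisted local system on the surface. The fibres at the sides other than
the two sides of the flipped edge are the same, and parallel transport around each of the four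
corners of the quadrilateral is the same. -/
structure IsFlip (F : FramedLocalSystem T n) (F' : FramedLocalSystem T' n) (v : V) : Prop where
  flip : T.IsFlip T' v
  edge_eq : ∀ (u : V) (h : T.opp u ≠ u) (h' : T'.opp u ≠ u), u ≠ v → u ≠ T.opp v →
    F'.edge ⟨u, h'⟩ = F.edge ⟨u, h⟩
  tri_eq : ∀ u, u ≠ v → u ≠ T.next v → u ≠ T.next (T.next v) →
    u ≠ T.opp v → u ≠ T.next (T.opp v) → u ≠ T.next (T.next (T.opp v)) → F'.tri u = F.tri u
  Lt_eq : ∀ u, u ≠ v → u ≠ T.opp v → F'.Lt u = F.Lt u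
  Lb_eq : ∀ u, u ≠ v → u ≠ T.opp v → F'.Lb u = F.Lb u
  corner_b : F'.tri (T.next (T.next v)) =
    F.tri (T.opp v) * F.edge ⟨v, flip.internal⟩ * F.tri (T.next (T.next v))
  corner_d : F'.tri (T.next (T.next (T.opp v))) =
    F.tri v * F.edge (rev ⟨v, flip.internal⟩) * F.tri (T.next (T.next (T.opp v)))
  corner_a : F.tri (T.next v) =
    F'.tri v * F'.edge (rev ⟨v, flip.internal'⟩) * F'.tri (T.next v)
  corner_c : F.tri (T.next (T.opp v)) =
    F'.tri (T.opp v) * F'.edge ⟨v, flip.internal'⟩ * F'.tri (T.next (T.opp v))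

/-- One flip, together with the corresponding change of the framed local system. -/
def FlipStep (n : ℕ) (p q : Σ T : IdealTriangulation V, FramedLocalSystem T n) : Prop :=
  ∃ v, IsFlip p.2 q.2 v

/-- A framed twisted local system is maximal if there is an ideal triangulation of the surface (that
is, one that is obtained from `T` by a sequence of flips) for which the Maslov indices of
all the triangles are equal to `n`. -/
def IsMaximal (F : FramedLocalSystem T n) : Prop :=
  ∃ p : Σ T : IdealTriangulation V, FramedLocalSystem T n,
    Relation.ReflTransGen (FlipStep n) ⟨T, F⟩ p ∧ p.2.AllMaslovMaximal

end FramedLocalSystem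

/-- The moduli space of framed `δ`-twisted symplectic local systems on the quiver of `T`,
with the quotient topology. -/
abbrev Moduli (T : IdealTriangulation V) (n : ℕ) : Type _ :=
  Quotient (FramedLocalSystem.setoid T n)

/-- The space of maximal framed twisted local systems. -/
def maximalModuli (T : IdealTriangulation V) (n : ℕ) : Set (Moduli T n) :=
  {c | ∃ F : FramedLocalSystem T n, F.IsMaximal ∧ (⟦F⟧ : Moduli T n) = c}

/-! ### Coordinates -/

/-- The space `𝒳⁺(T, n)`: the first component is the family `(x(a))` for `a ∈ A₂`, the second one
is the family `(x(a))` for `a ∈ A₃`. -/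
abbrev XPlus (T : IdealTriangulation V) (n : ℕ) : Type _ :=
  {x : (T.A₂ → Matrix (Fin n) (Fin n) ℝ) × (V → On n) //
    (∀ a, (x.1 a).PosDef) ∧ (∀ a, x.1 (rev a) = x.1 a) ∧
    ∀ v, x.2 (T.next (T.next v)) * x.2 (T.next v) * x.2 v = 1}

/-- Diagonal matrices with positive nondecreasing entries. -/
def Delta (n : ℕ) : Set (Matrix (Fin n) (Fin n) ℝ) :=
  {D | ∃ d : Fin n → ℝ, (∀ i, 0 < d i) ∧ Monotone d ∧ D = Matrix.diagonal d}

/-- The space `𝒳⁺_Δ(T, n)` of positive (diagonal) `𝒳`-coordinates. -/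
abbrev XPlusDelta (T : IdealTriangulation V) (n : ℕ) : Type _ :=
  {x : XPlus T n // ∀ a, x.1.1 a ∈ Delta n}

section holonomy

variable {n : ℕ}

theorem sqrt_mul_sqrt {S : Matrix (Fin n) (Fin n) ℝ} (hS : S.PosDef) :
    CFC.sqrt S * CFC.sqrt S = S :=
  CFC.sqrt_mul_sqrt_self S hS.posSemidef.nonneg

theorem sqrt_transpose (S : Matrix (Fin n) (Fin n) ℝ) : (CFC.sqrt S).transpose = CFC.sqrt S := by
  have := (Matrix.nonneg_iff_posSemidef.1 (CFC.sqrt_nonneg S)).isHermitian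
  simpa [Matrix.IsHermitian] using this

theorem sqrt_isUnit_det {S : Matrix (Fin n) (Fin n) ℝ} (hS : S.PosDef) :
    IsUnit (CFC.sqrt S).det := by
  have h : IsUnit ((CFC.sqrt S).det * (CFC.sqrt S).det) := by
    rw [← Matrix.det_mul, sqrt_mul_sqrt hS]
    exact (Matrix.isUnit_iff_isUnit_det _).1 hS.isUnit
  exact isUnit_of_mul_isUnit_left h

/-- The matrix with blocks `0, -S^{-1/2}; S^{1/2}, 0`. -/
def edgeMatrix (S : Matrix (Fin n) (Fin n) ℝ) (hS : S.PosDef) : Sp n :=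
  ⟨Matrix.fromBlocks 0 (-(CFC.sqrt S)⁻¹) (CFC.sqrt S) 0, by
    have hu := sqrt_isUnit_det hS
    rw [SymplecticGroup.mem_iff, Matrix.J, Matrix.fromBlocks_transpose,
      Matrix.fromBlocks_multiply, Matrix.fromBlocks_multiply]
    simp [Matrix.transpose_nonsing_inv, sqrt_transpose, Matrix.nonsing_inv_mul _ hu,
      Matrix.mul_nonsing_inv _ hu]⟩

/-- The matrix with blocks `u, -u; u, 0`. -/
def triMatrix (u : On n) : Sp n :=
  ⟨Matrix.fromBlocks u.1 (-u.1) u.1 0, by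
    have hu : u.1 * u.1.transpose = 1 := by
      have := (Matrix.mem_orthogonalGroup_iff (Fin n) ℝ).1 u.2
      simpa [Matrix.star_eq_conjTranspose] using this
    rw [SymplecticGroup.mem_iff, Matrix.J, Matrix.fromBlocks_transpose,
      Matrix.fromBlocks_multiply, Matrix.fromBlocks_multiply]
    simp [hu]⟩

theorem fromBlocks_mulVec_inl (A B C D : Matrix (Fin n) (Fin n) ℝ) (x : E n) (i : Fin n) :
    (Matrix.fromBlocks A B C D).mulVec x (Sum.inl i) =
      A.mulVec (x ∘ Sum.inl) i + B.mulVec (x ∘ Sum.inr) i := by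
  rw [Matrix.fromBlocks_mulVec]; rfl

theorem fromBlocks_mulVec_inr (A B C D : Matrix (Fin n) (Fin n) ℝ) (x : E n) (i : Fin n) :
    (Matrix.fromBlocks A B C D).mulVec x (Sum.inr i) =
      C.mulVec (x ∘ Sum.inl) i + D.mulVec (x ∘ Sum.inr) i := by
  rw [Matrix.fromBlocks_mulVec]; rfl

theorem smul_spanE_of_block {g : Sp n} {B C D : Matrix (Fin n) (Fin n) ℝ}
    (hg : g.1 = Matrix.fromBlocks 0 B C D) : g • spanE n = spanF n := by
  refine Lag.eq_of_le fun y hy => ?_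
  obtain ⟨x, hx, rfl⟩ := (mem_smul_lag _ _ _).1 hy
  refine mem_spanF.2 fun i => ?_
  have h0 : x ∘ Sum.inr = 0 := funext (mem_spanE.1 hx)
  rw [hg, fromBlocks_mulVec_inl, h0]
  simp

theorem smul_spanF_of_block {g : Sp n} {A B C : Matrix (Fin n) (Fin n) ℝ}
    (hg : g.1 = Matrix.fromBlocks A B C 0) : g • spanF n = spanE n := by
  refine Lag.eq_of_le fun y hy => ?_
  obtain ⟨x, hx, rfl⟩ := (mem_smul_lag _ _ _).1 hy
  refine mem_spanE.2 fun i => ?_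
  have h0 : x ∘ Sum.inl = 0 := funext (mem_spanF.1 hx)
  rw [hg, fromBlocks_mulVec_inr, h0]
  simp

/-- The framed twisted local system with transition matrices `G_a(x)` and with the framing
generated by the standard symplectic basis in every fibre. -/
def holSystem (T : IdealTriangulation V) (x : XPlus T n) : FramedLocalSystem T n where
  edge a := edgeMatrix (x.1.1 a) (x.2.1 a)
  tri v := triMatrix (x.1.2 v)
  Lt _ := spanE n
  Lb _ := spanF n
  edge_twisted a := by
    have hu := sqrt_isUnit_det (x.2.1 a)
    simp only [edgeMatrix, x.2.2.1 a, Matrix.fromBlocks_multiply]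
    rw [← Matrix.fromBlocks_one, Matrix.fromBlocks_neg]
    simp [Matrix.nonsing_inv_mul _ hu, Matrix.mul_nonsing_inv _ hu]
  tri_twisted v := by
    have h : (x.1.2 (T.next (T.next v))).1 * (x.1.2 (T.next v)).1 * (x.1.2 v).1 = 1 :=
      congrArg Subtype.val (x.2.2.2 v)
    simp only [triMatrix, Matrix.fromBlocks_multiply]
    rw [← Matrix.fromBlocks_one, Matrix.fromBlocks_neg]
    simp [h]
  edge_Lt _ := smul_spanE_of_block rfl
  edge_Lb _ := smul_spanF_of_block rfl
  tri_Lb _ := smul_spanF_of_block rfl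

/-- The holonomy map on `𝒳⁺(T, n)`. -/
def hol (T : IdealTriangulation V) (n : ℕ) (x : XPlus T n) : Moduli T n :=
  ⟦holSystem T x⟧

/-- The holonomy map on `𝒳⁺_Δ(T, n)`. -/
def holDelta (T : IdealTriangulation V) (n : ℕ) (x : XPlusDelta T n) : Moduli T n :=
  hol T n x.1

/-- The holonomy map on `𝒳⁺_Δ(T, n)`, as a map to the space of maximal framed local systems, given
that it takes its values there. -/
def holDeltaMax (T : IdealTriangulation V) (n : ℕ)
    (h : ∀ x : XPlusDelta T n, holDelta T n x ∈ maximalModuli T n) :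
    XPlusDelta T n → maximalModuli T n :=
  Set.codRestrict (holDelta T n) (maximalModuli T n) h

end holonomy

/-- A map is generically finite-to-one if it has finite fibres over a dense open subset of the
target, whose preimage is moreover dense in the source. -/
def GenericallyFiniteToOne {X Y : Type*} [TopologicalSpace X] [TopologicalSpace Y]
    (f : X → Y) : Prop :=
  ∃ U : Set Y, IsOpen U ∧ Dense U ∧ Dense (f ⁻¹' U) ∧ ∀ y ∈ U, (f ⁻¹' {y}).Finite

end FramedSp

end

open FramedSp FramedSp.IdealTriangulation

/-!
A triple of Lagrangians has Maslov index `n` exactly when its outer members are transverse and its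
middle one is the graph of a positive definite form (a *positive triple*). By the exchange relation
for positive triples, maximality for one ideal triangulation implies it for every flip, hence for
`T` itself. The group `Sp(2n, ℝ)` acts transitively on positive triples, and the stabilizer of the
standard triple `(span e, span (e + f), span f)` is the copy of `O(n)` given by the matrices
`diag(r, r)`.

Trivializing the fibres so that all the triples of the faces are standard, the transition matrix
across a face becomes `[[u, -u], [u, 0]]` with `u ∈ O(n)`, and the one across an internal edge is
antidiagonal, thus determined by an invertible `n × n` block. The remaining freedom in `O(n)` on
both sides of the edge is the freedom in the singular value decomposition of that block: its
existence gives surjectivity, its uniqueness the fibres.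

Since `Sp(2n, ℝ)` acts properly on positive triples, the map `(ψ, x) ↦ ψ • holSystem x` to the
maximal systems is proper, and properness of the holonomy descends from it. Over the
coordinates with simple spectrum, only diagonal orthogonal matrices occur in the description of the
fibres; there are finitely many of them.
-/

noncomputable section

open scoped MatrixOrder

namespace FramedSp

open IdealTriangulation

/-! ### The symplectic form and Lagrangian subspaces -/

section Lagrangian

variable {n : ℕ}

theorem omega_apply (x y : E n) :
    omega n x y = x ∘ Sum.inl ⬝ᵥ y ∘ Sum.inr - x ∘ Sum.inr ⬝ᵥ y ∘ Sum.inl := by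
  rw [omega, Matrix.toBilin'_apply', Matrix.fromBlocks_mulVec]
  simp [dotProduct, Fintype.sum_sum_type, sub_eq_add_neg, Matrix.neg_mulVec]

theorem omega_self (x : E n) : omega n x x = 0 := by
  rw [omega_apply, dotProduct_comm, sub_self]

theorem omega_swap (x y : E n) : omega n y x = -omega n x y := by
  rw [omega_apply, omega_apply, dotProduct_comm, dotProduct_comm (y ∘ Sum.inr), neg_sub]

theorem omega_nondegenerate : (omega n).Nondegenerate := by
  refine (LinearMap.IsRefl.nondegenerate_iff_separatingLeft fun x y h => ?_).2 fun x hx => ?_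
  · rw [omega_swap, h, neg_zero]
  · ext (i | i)
    · simpa [omega_apply, dotProduct, Pi.single_apply] using hx (Pi.single (Sum.inr i) 1)
    · simpa [omega_apply, dotProduct, Pi.single_apply] using hx (Pi.single (Sum.inl i) 1)

namespace Lag

theorem omega_eq_zero (L : Lag n) {x y : E n} (hx : x ∈ L.1) (hy : y ∈ L.1) : omega n x y = 0 :=
  L.2.2 x hx y hy

theorem mem_of_omega_eq_zero (L : Lag n) {x : E n} (hx : ∀ y ∈ L.1, omega n y x = 0) :
    x ∈ L.1 := by
  have hle : L.1 ≤ (omega n).orthogonal L.1 := fun _ hx _ hy => L.omega_eq_zero hy hx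
  have hdim := LinearMap.BilinForm.finrank_orthogonal omega_nondegenerate L.1
  have hE : Module.finrank ℝ (E n) = n + n := by simp
  rw [hE, L.2.1, Nat.add_sub_cancel] at hdim
  rw [Submodule.eq_of_le_of_finrank_eq hle (L.2.1.trans hdim.symm)]
  exact hx

theorem isCompl_of_disjoint {L M : Lag n} (h : Disjoint L.1 M.1) : IsCompl L.1 M.1 :=
  (Submodule.isCompl_iff_disjoint _ _ (by rw [L.2.1, M.2.1]; simp)).2 h

theorem mulVec_mem_smul_iff (g : Sp n) (L : Lag n) {x : E n} :
    g.1.mulVec x ∈ (g • L).1 ↔ x ∈ L.1 :=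
  ⟨fun ⟨_, hy, hxy⟩ => mulVec_injective g hxy ▸ hy, fun hx => ⟨x, hx, rfl⟩⟩

theorem smul_eq_of_forall {g : Sp n} {L M : Lag n} (h : ∀ x ∈ L.1, g.1.mulVec x ∈ M.1) :
    g • L = M :=
  Lag.eq_of_le (Submodule.map_le_iff_le_comap.2 h)

end Lag

end Lagrangian

/-! ### Positive triples of Lagrangians -/

/-- A positive triple of Lagrangians: `L₁` and `L₂` are transverse, and `M` is the graph of a map
`L₁ → L₂` whose associated bilinear form on `L₁` is positive definite. These are the triples of
maximal Maslov index. -/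
structure PosTriple {n : ℕ} (L₁ M L₂ : Lag n) : Prop where
  disjoint : Disjoint L₁.1 L₂.1
  pos : ∀ v ∈ L₁.1, ∀ x ∈ L₂.1, v + x ∈ M.1 → v + x ≠ 0 → 0 < omega n v x

namespace PosTriple

variable {n : ℕ} {L₁ L₂ L₃ L₄ : Lag n}

theorem nonneg (h : PosTriple L₁ L₂ L₃) {v x : E n} (hv : v ∈ L₁.1) (hx : x ∈ L₃.1)
    (hw : v + x ∈ L₂.1) : 0 ≤ omega n v x := by
  by_cases h0 : v + x = 0
  · rw [← add_eq_zero_iff_neg_eq.1 h0, map_neg, omega_self, neg_zero]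
  · exact (h.pos v hv x hx hw h0).le

theorem rotate (h : PosTriple L₁ L₂ L₃) : PosTriple L₂ L₃ L₁ := by
  refine ⟨Submodule.disjoint_def.2 fun w h₂ h₁ => ?_, fun m hm l hl hx hne => ?_⟩
  · by_contra hw
    simpa using h.pos w h₁ 0 (zero_mem _) (by simpa using h₂) (by simpa using hw)
  · have hm0 : m ≠ 0 := by
      rintro rfl
      rw [zero_add] at hx hne
      exact hne (Submodule.disjoint_def.1 h.disjoint l hl hx)
    have hpos := h.pos (-l) (neg_mem hl) (m + l) hx (by simpa using hm) (by simpa using hm0)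
    rw [omega_swap] at hpos
    simpa [omega_self] using hpos

theorem exchange (h : PosTriple L₁ L₂ L₃) (h' : PosTriple L₁ L₃ L₄) : PosTriple L₁ L₂ L₄ := by
  refine ⟨h'.disjoint, fun v hv x hx hw hne => ?_⟩
  have htop := (Lag.isCompl_of_disjoint h.disjoint).sup_eq_top
  obtain ⟨v₁, hv₁, v₃, hv₃, hsum⟩ := Submodule.mem_sup.1
    (htop ▸ Submodule.mem_top : v + x ∈ L₁.1 ⊔ L₃.1)
  have hp : 0 < omega n v₁ v₃ := h.pos v₁ hv₁ v₃ hv₃ (hsum ▸ hw) (hsum ▸ hne)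
  obtain rfl : v₃ + (v₁ - v) = x := by
    rw [add_sub, add_comm v₃, hsum, add_sub_cancel_left]
  have hq : 0 ≤ omega n v₃ (v₁ - v) := h'.rotate.nonneg hv₃ (sub_mem hv₁ hv) hx
  rw [omega_swap, map_sub, LinearMap.sub_apply] at hq
  simp only [map_add, map_sub, L₁.omega_eq_zero hv hv₁, omega_self]
  linarith

theorem smul (g : Sp n) (h : PosTriple L₁ L₂ L₃) : PosTriple (g • L₁) (g • L₂) (g • L₃) := by
  refine ⟨Submodule.disjoint_def.2 ?_, ?_⟩
  · rintro _ ⟨x, hx, rfl⟩ hx'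
    change g.1.mulVec x ∈ _ at hx'
    rw [Lag.mulVec_mem_smul_iff] at hx'
    rw [Submodule.disjoint_def.1 h.disjoint x hx hx', map_zero]
  · rintro _ ⟨v, hv, rfl⟩ _ ⟨x, hx, rfl⟩ hsum hne
    rw [← map_add] at hsum hne
    change g.1.mulVec (v + x) ∈ _ at hsum
    rw [Lag.mulVec_mem_smul_iff] at hsum
    exact (h.pos v hv x hx hsum fun h0 => hne (by rw [h0, map_zero])).trans_eq
      (omega_mulVec g v x).symm

end PosTriple

/-! ### The Maslov index -/

section Signature

variable {M N : Type*} [AddCommGroup M] [Module ℝ M] [Module.Finite ℝ M] [AddCommGroup N]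
  [Module ℝ N] {Q : QuadraticForm ℝ M} {f : N →ₗ[ℝ] M}

theorem finrank_le_sigPos_of_linearMap (hf : ∀ x, x ≠ 0 → 0 < Q (f x)) :
    Module.finrank ℝ N ≤ sigPos Q := by
  have hinj : Function.Injective f := (injective_iff_map_eq_zero f).2 fun x hx => by
    by_contra h
    simpa [hx] using hf x h
  rw [← LinearMap.finrank_range_of_inj hinj]
  refine le_sigPos_of_posDef Q ?_
  rintro ⟨_, x, rfl⟩ hx
  exact hf x fun h => hx (by simp [h])

theorem sigPos_add_finrank_le_of_linearMap (hinj : Function.Injective f)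
    (hf : ∀ x, Q (f x) ≤ 0) : sigPos Q + Module.finrank ℝ N ≤ Module.finrank ℝ M := by
  rw [← LinearMap.finrank_range_of_inj hinj]
  refine QuadraticForm.sigPos_add_finrank_le_of_nonpos ?_
  rintro _ ⟨x, rfl⟩
  exact hf x

end Signature

section Maslov

variable {n : ℕ} {L₁ M L₂ : Lag n}

theorem maslovForm_apply (p : L₁.1 × M.1 × L₂.1) :
    maslovForm L₁ M L₂ p =
      omega n p.1 p.2.1 + omega n p.2.1 p.2.2 + omega n p.2.2 p.1 := by
  simp [maslovForm]

theorem polar_maslovForm (p q : L₁.1 × M.1 × L₂.1) :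
    QuadraticMap.polar (maslovForm L₁ M L₂) p q =
      omega n q.1 (p.2.1 - p.2.2) + omega n q.2.1 (p.2.2 - p.1) + omega n q.2.2 (p.1 - p.2.1) := by
  simp only [QuadraticMap.polar, maslovForm_apply, Prod.fst_add, Prod.snd_add, Submodule.coe_add,
    map_add, map_sub, LinearMap.add_apply]
  rw [omega_swap (q.2.1 : E n) p.1, omega_swap (q.2.2 : E n) p.2.1, omega_swap (q.1 : E n) p.2.2]
  ring

theorem mem_radical_maslovForm {p : L₁.1 × M.1 × L₂.1} :
    p ∈ (maslovForm L₁ M L₂).radical ↔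
      (p.2.1 - p.2.2 : E n) ∈ L₁.1 ∧ (p.2.2 - p.1 : E n) ∈ M.1 ∧ (p.1 - p.2.1 : E n) ∈ L₂.1 := by
  rw [QuadraticMap.radical_eq_ker_polarBilin, LinearMap.mem_ker, LinearMap.ext_iff]
  simp only [QuadraticMap.polarBilin_apply_apply, LinearMap.zero_apply, polar_maslovForm]
  refine ⟨fun h => ⟨?_, ?_, ?_⟩, fun ⟨h₁, h₂, h₃⟩ q => ?_⟩
  · exact L₁.mem_of_omega_eq_zero fun y hy => by simpa using h (⟨y, hy⟩, 0, 0)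
  · exact M.mem_of_omega_eq_zero fun y hy => by simpa using h (0, ⟨y, hy⟩, 0)
  · exact L₂.mem_of_omega_eq_zero fun y hy => by simpa using h (0, 0, ⟨y, hy⟩)
  · rw [L₁.omega_eq_zero q.1.2 h₁, M.omega_eq_zero q.2.1.2 h₂, L₂.omega_eq_zero q.2.2.2 h₃]
    simp

theorem finrank_lag_prod (L₁ M L₂ : Lag n) :
    Module.finrank ℝ (L₁.1 × M.1 × L₂.1) = 3 * n := by
  rw [Module.finrank_prod, Module.finrank_prod, L₁.2.1, M.2.1, L₂.2.1]
  ring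

theorem three_mul_finrank_inf_le (L₁ M L₂ : Lag n) :
    3 * Module.finrank ℝ (L₁.1 ⊓ M.1 ⊓ L₂.1 : Submodule ℝ (E n)) ≤
      Module.finrank ℝ (maslovForm L₁ M L₂).radical := by
  set K : Submodule ℝ (E n) := L₁.1 ⊓ M.1 ⊓ L₂.1
  have h₁ : K ≤ L₁.1 := inf_le_left.trans inf_le_left
  have h₂ : K ≤ M.1 := inf_le_left.trans inf_le_right
  have h₃ : K ≤ L₂.1 := inf_le_right
  let f : K × K × K →ₗ[ℝ] L₁.1 × M.1 × L₂.1 :=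
    (Submodule.inclusion h₁).prodMap ((Submodule.inclusion h₂).prodMap (Submodule.inclusion h₃))
  have hinj : Function.Injective f :=
    (Submodule.inclusion_injective h₁).prodMap
      ((Submodule.inclusion_injective h₂).prodMap (Submodule.inclusion_injective h₃))
  have hrange : LinearMap.range f ≤ (maslovForm L₁ M L₂).radical := by
    rintro _ ⟨⟨a, b, c⟩, rfl⟩
    exact mem_radical_maslovForm.2
      ⟨h₁ (sub_mem b.2 c.2), h₂ (sub_mem c.2 a.2), h₃ (sub_mem a.2 b.2)⟩
  calc 3 * Module.finrank ℝ K = Module.finrank ℝ (K × K × K) := by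
        rw [Module.finrank_prod, Module.finrank_prod]; ring
    _ = Module.finrank ℝ (LinearMap.range f) := (LinearMap.finrank_range_of_inj hinj).symm
    _ ≤ _ := Submodule.finrank_mono hrange

theorem finrank_range_inl_inf_radical_le (L₁ M L₂ : Lag n) :
    Module.finrank ℝ (LinearMap.range (LinearMap.inl ℝ L₁.1 (M.1 × L₂.1)) ⊓
        (maslovForm L₁ M L₂).radical : Submodule ℝ (L₁.1 × M.1 × L₂.1)) ≤
      Module.finrank ℝ (L₁.1 ⊓ M.1 ⊓ L₂.1 : Submodule ℝ (E n)) := by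
  let f : (L₁.1 ⊓ M.1 ⊓ L₂.1 : Submodule ℝ (E n)) →ₗ[ℝ] L₁.1 × M.1 × L₂.1 :=
    LinearMap.inl ℝ L₁.1 (M.1 × L₂.1) ∘ₗ
      Submodule.inclusion (inf_le_left.trans inf_le_left)
  refine (Submodule.finrank_mono ?_).trans (LinearMap.finrank_range_le f)
  rintro _ ⟨⟨v, rfl⟩, hv⟩
  obtain ⟨-, hM, hL₂⟩ := mem_radical_maslovForm.1 hv
  exact ⟨⟨v.1, ⟨v.2, by simpa using hM⟩, by simpa using hL₂⟩, rfl⟩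

/-- The form is nonpositive on `L₁ + radical`, which would be too large if the radical were not
zero, since `L₁ ∩ radical` has at most a third of the dimension of the radical. -/
theorem radical_maslovForm_eq_bot (h : maslovIndex L₁ M L₂ = n) :
    (maslovForm L₁ M L₂).radical = ⊥ := by
  set Q := maslovForm L₁ M L₂ with hQ
  set A := LinearMap.range (LinearMap.inl ℝ L₁.1 (M.1 × L₂.1)) with hA
  have hnonpos : ∀ x ∈ A ⊔ Q.radical, Q x ≤ 0 := by
    intro x hx
    obtain ⟨_, ⟨v, rfl⟩, r, hr, rfl⟩ := Submodule.mem_sup.1 hx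
    rw [add_comm, (QuadraticMap.mem_radical_iff'.1 hr).2, hQ, maslovForm_apply]
    simp
  have hle := QuadraticForm.sigPos_add_finrank_le_of_nonpos hnonpos
  have hsup := Submodule.finrank_sup_add_finrank_inf_eq A Q.radical
  have hdimA : Module.finrank ℝ A = n := by
    rw [hA, LinearMap.finrank_range_of_inj LinearMap.inl_injective, L₁.2.1]
  have hdim := finrank_lag_prod L₁ M L₂
  have hsum := QuadraticForm.sigPos_add_sigNeg_add_radical (Q := Q)
  have hthree := three_mul_finrank_inf_le L₁ M L₂
  have hinf := finrank_range_inl_inf_radical_le L₁ M L₂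
  rw [← hQ] at hthree hinf
  rw [← hA] at hinf
  rw [maslovIndex, ← hQ] at h
  exact Submodule.finrank_eq_zero.1 (by lia)

theorem two_mul_le_sigPos_maslovForm (h : maslovIndex L₁ M L₂ = n) :
    2 * n ≤ sigPos (maslovForm L₁ M L₂) := by
  have hdim := finrank_lag_prod L₁ M L₂
  have hsum := QuadraticForm.sigPos_add_sigNeg_add_radical (Q := maslovForm L₁ M L₂)
  rw [radical_maslovForm_eq_bot h, finrank_bot] at hsum
  rw [maslovIndex] at h
  lia

theorem disjoint_of_radical_maslovForm_eq_bot (h : (maslovForm L₁ M L₂).radical = ⊥) :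
    Disjoint L₁.1 L₂.1 := by
  refine Submodule.disjoint_def.2 fun a ha₁ ha₂ => ?_
  have hmem : (⟨a, ha₁⟩, 0, ⟨a, ha₂⟩) ∈ (maslovForm L₁ M L₂).radical :=
    mem_radical_maslovForm.2 (by simpa using ⟨ha₁, ha₂⟩)
  rw [h, Submodule.mem_bot, Prod.mk_eq_zero] at hmem
  exact congrArg Subtype.val hmem.1

theorem sigPos_maslovForm_lt {v x : E n} (hv : v ∈ L₁.1) (hx : x ∈ L₂.1) (hw : v + x ∈ M.1)
    (hne : v + x ≠ 0) (hle : omega n v x ≤ 0) : sigPos (maslovForm L₁ M L₂) < 2 * n := by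
  let p : L₁.1 × M.1 × L₂.1 := (⟨v, hv⟩, ⟨v + x, hw⟩, ⟨x, hx⟩)
  let f : L₁.1 × ℝ →ₗ[ℝ] L₁.1 × M.1 × L₂.1 :=
    (LinearMap.inl ℝ L₁.1 (M.1 × L₂.1)).coprod (LinearMap.toSpanSingleton ℝ _ p)
  have hf : ∀ a t, f (a, t) = (a + t • p.1, t • p.2.1, t • p.2.2) := fun a t => by simp [f, p]
  have hinj : Function.Injective f := by
    refine (injective_iff_map_eq_zero f).2 ?_
    rintro ⟨a, t⟩ hat
    simp only [hf, Prod.mk_eq_zero] at hat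
    obtain rfl : t = 0 :=
      (smul_eq_zero.1 hat.2.1).resolve_right fun h => hne (congrArg Subtype.val h)
    simpa using hat.1
  have hnonpos : ∀ q, maslovForm L₁ M L₂ (f q) ≤ 0 := by
    rintro ⟨a, t⟩
    have hQ : maslovForm L₁ M L₂ (f (a, t)) = t ^ 2 * omega n v x := by
      simp [hf, p, maslovForm_apply, L₁.omega_eq_zero a.2 hv, omega_swap (a : E n) x,
        omega_swap v x, omega_self]
      ring
    rw [hQ]
    exact mul_nonpos_of_nonneg_of_nonpos (sq_nonneg t) hle
  have hdim := sigPos_add_finrank_le_of_linearMap hinj hnonpos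
  rw [finrank_lag_prod, Module.finrank_prod, L₁.2.1, Module.finrank_self] at hdim
  lia

theorem posTriple_of_maslovIndex (h : maslovIndex L₁ M L₂ = n) : PosTriple L₁ M L₂ where
  disjoint := disjoint_of_radical_maslovForm_eq_bot (radical_maslovForm_eq_bot h)
  pos _ hv _ hx hw hne := by
    by_contra! hle
    exact (sigPos_maslovForm_lt hv hx hw hne hle).not_ge (two_mul_le_sigPos_maslovForm h)

theorem PosTriple.exists_linearMap (h : PosTriple L₁ M L₂) :
    ∃ (v : M.1 →ₗ[ℝ] L₁.1) (x : M.1 →ₗ[ℝ] L₂.1), (∀ w, (v w + x w : E n) = w) ∧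
      ∀ w, w ≠ 0 → 0 < omega n (v w) (x w) := by
  have hcompl := Lag.isCompl_of_disjoint h.disjoint
  let v : M.1 →ₗ[ℝ] L₁.1 := L₁.1.projectionOnto L₂.1 hcompl ∘ₗ M.1.subtype
  let x : M.1 →ₗ[ℝ] L₂.1 := L₂.1.projectionOnto L₁.1 hcompl.symm ∘ₗ M.1.subtype
  have hvx (w : M.1) : (v w + x w : E n) = w :=
    Submodule.projection_add_projection_eq_self hcompl (w : E n)
  exact ⟨v, x, hvx, fun w hw =>
    h.pos _ (v w).2 _ (x w).2 (by rw [hvx]; exact w.2) (by rw [hvx]; simpa using hw)⟩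

/-- With `v` and `x` the projections of `M` to `L₁` and `L₂`, the form takes the positive value
`ω(v w, x w) + ω(v z, x z)` at `(v w + v z, w, x w - x z)` and the negative value `-ω(v z, x z)` at
`(v z, 0, x z)`. -/
theorem PosTriple.maslovIndex_eq (h : PosTriple L₁ M L₂) : maslovIndex L₁ M L₂ = n := by
  set Q := maslovForm L₁ M L₂ with hQ
  obtain ⟨v, x, hvx, hpos⟩ := h.exists_linearMap
  have hnonneg (w : M.1) : 0 ≤ omega n (v w) (x w) :=
    (eq_or_ne w 0).elim (fun hw => by simp [hw]) fun hw => (hpos w hw).le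
  have hplus : Module.finrank ℝ (M.1 × M.1) ≤ sigPos Q := by
    let pr₁ := LinearMap.fst ℝ M.1 M.1
    let pr₂ := LinearMap.snd ℝ M.1 M.1
    refine finrank_le_sigPos_of_linearMap
      (f := (v ∘ₗ (pr₁ + pr₂)).prod (pr₁.prod (x ∘ₗ (pr₁ - pr₂)))) ?_
    rintro ⟨w, z⟩ hne
    have hval : Q (v (w + z), w, x (w - z)) = omega n (v w) (x w) + omega n (v z) (x z) := by
      rw [hQ, maslovForm_apply, ← hvx w]
      simp [L₁.omega_eq_zero (v z).2 (v w).2, L₂.omega_eq_zero (x w).2 (x z).2, omega_self,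
        omega_swap (v w : E n) (x w), omega_swap (v z : E n) (x w),
        omega_swap (v w : E n) (x z), omega_swap (v z : E n) (x z)]
      ring
    refine lt_of_lt_of_eq ?_ hval.symm
    rcases eq_or_ne w 0 with rfl | hw
    · exact add_pos_of_nonneg_of_pos (hnonneg 0) (hpos z fun hz => hne (by rw [hz]; rfl))
    · exact add_pos_of_pos_of_nonneg (hpos w hw) (hnonneg z)
  have hminus : Module.finrank ℝ M.1 ≤ sigPos (-Q) := by
    refine finrank_le_sigPos_of_linearMap (f := v.prod ((0 : M.1 →ₗ[ℝ] M.1).prod x)) ?_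
    intro z hz
    have hval : (-Q) (v z, 0, x z) = omega n (v z) (x z) := by
      rw [neg_apply, hQ, maslovForm_apply, omega_swap (v z : E n)]
      simp
    exact (hpos z hz).trans_eq hval.symm
  have hsum := QuadraticForm.sigPos_add_sigNeg_add_radical (Q := Q)
  rw [finrank_lag_prod] at hsum
  rw [sigPos_neg] at hminus
  rw [Module.finrank_prod, M.2.1] at hplus
  rw [M.2.1] at hminus
  rw [maslovIndex, ← hQ]
  lia

theorem maslovIndex_eq_iff_posTriple : maslovIndex L₁ M L₂ = n ↔ PosTriple L₁ M L₂ :=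
  ⟨posTriple_of_maslovIndex, PosTriple.maslovIndex_eq⟩

end Maslov

/-! ### Block decompositions of symplectic matrices -/

section Blocks

variable {n : ℕ}

theorem elim_mem_spanE_iff {x y : Fin n → ℝ} : (Sum.elim x y : E n) ∈ (spanE n).1 ↔ y = 0 :=
  mem_spanE.trans funext_iff.symm

theorem elim_mem_spanF_iff {x y : Fin n → ℝ} : (Sum.elim x y : E n) ∈ (spanF n).1 ↔ x = 0 :=
  mem_spanF.trans funext_iff.symm

theorem mem_spanE_iff_exists {v : E n} : v ∈ (spanE n).1 ↔ ∃ z, (Sum.elim z 0 : E n) = v := by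
  obtain ⟨x, y, rfl⟩ : ∃ x y, v = Sum.elim x y := ⟨_, _, (Sum.elim_comp_inl_inr v).symm⟩
  simp [elim_mem_spanE_iff, Sum.elim_eq_iff, eq_comm]

theorem mem_spanF_iff_exists {v : E n} : v ∈ (spanF n).1 ↔ ∃ z, (Sum.elim 0 z : E n) = v := by
  obtain ⟨x, y, rfl⟩ : ∃ x y, v = Sum.elim x y := ⟨_, _, (Sum.elim_comp_inl_inr v).symm⟩
  simp [elim_mem_spanF_iff, Sum.elim_eq_iff, eq_comm]

theorem mulVec_elim (g : Matrix (Fin n ⊕ Fin n) (Fin n ⊕ Fin n) ℝ) (x y : Fin n → ℝ) :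
    g.mulVec (Sum.elim x y) = Sum.elim (g.toBlocks₁₁.mulVec x + g.toBlocks₁₂.mulVec y)
      (g.toBlocks₂₁.mulVec x + g.toBlocks₂₂.mulVec y) := by
  conv_lhs => rw [← Matrix.fromBlocks_toBlocks g]
  rw [Matrix.fromBlocks_mulVec]
  rfl

/-- The Lagrangian `Span(e₁ + f₁, …, eₙ + fₙ)`, the middle term of the standard positive triple. -/
def spanD (n : ℕ) : Lag n := triMatrix (1 : On n) • spanE n

theorem mem_spanD_iff_exists {v : E n} : v ∈ (spanD n).1 ↔ ∃ z, (Sum.elim z z : E n) = v := by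
  have key (z : Fin n → ℝ) : (triMatrix (1 : On n)).1.mulVec (Sum.elim z 0) = Sum.elim z z := by
    simp [mulVec_elim, triMatrix]
  simp [spanD, mem_smul_lag, mem_spanE_iff_exists, key]

theorem elim_mem_spanD_iff {x y : Fin n → ℝ} : (Sum.elim x y : E n) ∈ (spanD n).1 ↔ x = y := by
  simp [mem_spanD_iff_exists, Sum.elim_eq_iff, eq_comm]

theorem smul_spanE_eq_iff {g : Sp n} {L : Lag n} :
    g • spanE n = L ↔ ∀ z, g.1.mulVec (Sum.elim z 0) ∈ L.1 := by
  refine ⟨?_, fun h => Lag.smul_eq_of_forall fun x hx => ?_⟩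
  · rintro rfl z
    rw [Lag.mulVec_mem_smul_iff, elim_mem_spanE_iff]
  · obtain ⟨z, rfl⟩ := mem_spanE_iff_exists.1 hx
    exact h z

theorem smul_spanF_eq_iff {g : Sp n} {L : Lag n} :
    g • spanF n = L ↔ ∀ z, g.1.mulVec (Sum.elim 0 z) ∈ L.1 := by
  refine ⟨?_, fun h => Lag.smul_eq_of_forall fun x hx => ?_⟩
  · rintro rfl z
    rw [Lag.mulVec_mem_smul_iff, elim_mem_spanF_iff]
  · obtain ⟨z, rfl⟩ := mem_spanF_iff_exists.1 hx
    exact h z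

theorem smul_spanD_eq_iff {g : Sp n} {L : Lag n} :
    g • spanD n = L ↔ ∀ z, g.1.mulVec (Sum.elim z z) ∈ L.1 := by
  refine ⟨?_, fun h => Lag.smul_eq_of_forall fun x hx => ?_⟩
  · rintro rfl z
    rw [Lag.mulVec_mem_smul_iff, elim_mem_spanD_iff]
  · obtain ⟨z, rfl⟩ := mem_spanD_iff_exists.1 hx
    exact h z

theorem smul_spanE_eq_spanE_iff {g : Sp n} : g • spanE n = spanE n ↔ g.1.toBlocks₂₁ = 0 := by
  simp [smul_spanE_eq_iff, mulVec_elim, elim_mem_spanE_iff, Matrix.ext_iff_mulVec]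

theorem smul_spanE_eq_spanF_iff {g : Sp n} : g • spanE n = spanF n ↔ g.1.toBlocks₁₁ = 0 := by
  simp [smul_spanE_eq_iff, mulVec_elim, elim_mem_spanF_iff, Matrix.ext_iff_mulVec]

theorem smul_spanF_eq_spanE_iff {g : Sp n} : g • spanF n = spanE n ↔ g.1.toBlocks₂₂ = 0 := by
  simp [smul_spanF_eq_iff, mulVec_elim, elim_mem_spanE_iff, Matrix.ext_iff_mulVec]

theorem smul_spanF_eq_spanF_iff {g : Sp n} : g • spanF n = spanF n ↔ g.1.toBlocks₁₂ = 0 := by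
  simp [smul_spanF_eq_iff, mulVec_elim, elim_mem_spanF_iff, Matrix.ext_iff_mulVec]

theorem smul_spanD_eq_spanD_iff {g : Sp n} : g • spanD n = spanD n ↔
    g.1.toBlocks₁₁ + g.1.toBlocks₁₂ = g.1.toBlocks₂₁ + g.1.toBlocks₂₂ := by
  simp [smul_spanD_eq_iff, mulVec_elim, elim_mem_spanD_iff, Matrix.ext_iff_mulVec,
    Matrix.add_mulVec]

theorem toBlocks_transpose_mul_sub_eq_one (g : Sp n) :
    g.1.toBlocks₁₁.transpose * g.1.toBlocks₂₂ - g.1.toBlocks₂₁.transpose * g.1.toBlocks₁₂ = 1 := by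
  have h := g.2
  rw [← Matrix.fromBlocks_toBlocks g.1, SymplecticGroup.fromBlocks_mem_iff] at h
  exact h.2.2

theorem posTriple_spanE_spanD_spanF (n : ℕ) : PosTriple (spanE n) (spanD n) (spanF n) := by
  refine ⟨Submodule.disjoint_def.2 fun x hE hF => ?_, fun v hv x hx hw hne => ?_⟩
  · ext (i | i)
    exacts [mem_spanF.1 hF i, mem_spanE.1 hE i]
  · obtain ⟨y, rfl⟩ := mem_spanE_iff_exists.1 hv
    obtain ⟨z, rfl⟩ := mem_spanF_iff_exists.1 hx
    rw [← Sum.elim_add_add, add_zero, zero_add, elim_mem_spanD_iff] at hw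
    subst hw
    have hy : y ≠ 0 := by
      rintro rfl
      exact hne (by ext (i | i) <;> simp)
    simpa [omega_apply] using Matrix.dotProduct_star_self_pos_iff.2 hy

end Blocks

/-! ### The action of the symplectic group on Lagrangians and on positive triples -/

section NormalForm

variable {n : ℕ}

theorem exists_sp_of_basis {e f : Fin n → E n} (hee : ∀ i j, omega n (e i) (e j) = 0)
    (hff : ∀ i j, omega n (f i) (f j) = 0)
    (hef : ∀ i j, omega n (e i) (f j) = (1 : Matrix (Fin n) (Fin n) ℝ) i j) :
    ∃ g : Sp n, ∀ x y : Fin n → ℝ, g.1.mulVec (Sum.elim x y) =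
      Fintype.linearCombination ℝ e x + Fintype.linearCombination ℝ f y := by
  let g : Matrix (Fin n ⊕ Fin n) (Fin n ⊕ Fin n) ℝ := (Matrix.of (Sum.elim e f)).transpose
  have hg : g ∈ Matrix.symplecticGroup (Fin n) ℝ := by
    rw [SymplecticGroup.mem_iff']
    have key (p q) : (g.transpose * Matrix.J (Fin n) ℝ * g) p q =
        -omega n (Sum.elim e f p) (Sum.elim e f q) := by
      rw [omega_eq, neg_neg, Matrix.mul_assoc, Matrix.mul_apply']
      rfl
    ext (i | i) (j | j) <;> rw [key]
    · simp [hee, Matrix.J]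
    · simp [hef, Matrix.J]
    · rw [omega_swap]
      simp [hef, Matrix.J, Matrix.one_apply, eq_comm]
    · simp [hff, Matrix.J]
  refine ⟨⟨g, hg⟩, fun x y => ?_⟩
  ext p
  simp [Matrix.mulVec, dotProduct, g, mul_comm, Fintype.linearCombination_apply]

theorem omega_linearCombination {ι κ : Type*} [Fintype ι] [Fintype κ] (b : ι → E n) (c : κ → E n)
    (x : ι → ℝ) (y : κ → ℝ) :
    omega n (Fintype.linearCombination ℝ b x) (Fintype.linearCombination ℝ c y) =
      x ⬝ᵥ (Matrix.of fun i j => omega n (b i) (c j)).mulVec y := by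
  simp only [Fintype.linearCombination_apply, map_sum, LinearMap.sum_apply, map_smul,
    LinearMap.smul_apply, smul_eq_mul, dotProduct, Matrix.mulVec, Matrix.of_apply, Finset.mul_sum]
  rw [Finset.sum_comm]
  exact Finset.sum_congr rfl fun i _ => Finset.sum_congr rfl fun j _ => by ring

theorem inv_sqrt_mul_self_mul_inv_sqrt {G : Matrix (Fin n) (Fin n) ℝ} (hG : G.PosDef) :
    (CFC.sqrt G)⁻¹ * G * (CFC.sqrt G)⁻¹ = 1 := by
  have hu := sqrt_isUnit_det hG
  nth_rewrite 2 [← sqrt_mul_sqrt hG]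
  rw [Matrix.nonsing_inv_mul_cancel_left _ _ hu, Matrix.mul_nonsing_inv _ hu]

theorem inv_sqrt_transpose (G : Matrix (Fin n) (Fin n) ℝ) :
    (CFC.sqrt G)⁻¹.transpose = (CFC.sqrt G)⁻¹ := by
  rw [Matrix.transpose_nonsing_inv, sqrt_transpose]

/-- Two isotropic families whose mutual pairing is symmetric and positive definite become the two
halves of a symplectic basis after the same linear change of variables `R`. -/
theorem exists_sp_of_pos {b c : Fin n → E n} (hbb : ∀ i j, omega n (b i) (b j) = 0)
    (hcc : ∀ i j, omega n (c i) (c j) = 0)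
    (hsymm : ∀ i j, omega n (b i) (c j) = omega n (b j) (c i))
    (hpos : ∀ x, x ≠ 0 →
      0 < omega n (Fintype.linearCombination ℝ b x) (Fintype.linearCombination ℝ c x)) :
    ∃ (g : Sp n) (R : Matrix (Fin n) (Fin n) ℝ), ∀ x y, g.1.mulVec (Sum.elim x y) =
      Fintype.linearCombination ℝ b (Matrix.vecMul x R) +
        Fintype.linearCombination ℝ c (Matrix.vecMul y R) := by
  have hG : (Matrix.of fun i j => omega n (b i) (c j)).PosDef := by
    refine Matrix.PosDef.of_dotProduct_mulVec_pos (Matrix.ext fun i j => ?_) fun x hx => ?_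
    · exact (hsymm j i)
    · rw [star_trivial, ← omega_linearCombination]
      exact hpos x hx
  obtain ⟨R, hR⟩ : ∃ R : Matrix (Fin n) (Fin n) ℝ,
      R * (Matrix.of fun i j => omega n (b i) (c j)) * R.transpose = 1 :=
    ⟨_, by rw [inv_sqrt_transpose, inv_sqrt_mul_self_mul_inv_sqrt hG]⟩
  have hlin (u : Fin n → E n) (x : Fin n → ℝ) :
      Fintype.linearCombination ℝ (fun i => Fintype.linearCombination ℝ u (R i)) x =
        Fintype.linearCombination ℝ u (Matrix.vecMul x R) := by
    rw [Matrix.vecMul_eq_sum, map_sum, Fintype.linearCombination_apply]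
    simp only [map_smul]
  have hzero {u : Fin n → E n} (hu : ∀ i j, omega n (u i) (u j) = 0) (x y : Fin n → ℝ) :
      omega n (Fintype.linearCombination ℝ u x) (Fintype.linearCombination ℝ u y) = 0 := by
    simp [omega_linearCombination, hu, dotProduct, Matrix.mulVec]
  obtain ⟨g, hg⟩ := exists_sp_of_basis (e := fun i => Fintype.linearCombination ℝ b (R i))
    (f := fun i => Fintype.linearCombination ℝ c (R i)) (fun i j => hzero hbb _ _)
    (fun i j => hzero hcc _ _) fun i j => by
      rw [omega_linearCombination, ← hR, Matrix.mul_assoc, Matrix.mul_apply']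
      rfl
  exact ⟨g, R, fun x y => by rw [hg, hlin, hlin]⟩

theorem PosTriple.exists_sp {L₁ M L₂ : Lag n} (h : PosTriple L₁ M L₂) :
    ∃ g : Sp n, g • spanE n = L₁ ∧ g • spanD n = M ∧ g • spanF n = L₂ := by
  obtain ⟨v, x, hvx, hpos⟩ := h.exists_linearMap
  let w := Module.finBasisOfFinrankEq ℝ M.1 M.2.1
  have hv (z : Fin n → ℝ) : Fintype.linearCombination ℝ (fun i => (v (w i) : E n)) z =
      v (Fintype.linearCombination ℝ w z) := by
    simp [Fintype.linearCombination_apply]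
  have hx (z : Fin n → ℝ) : Fintype.linearCombination ℝ (fun i => (x (w i) : E n)) z =
      x (Fintype.linearCombination ℝ w z) := by
    simp [Fintype.linearCombination_apply]
  have hsymm (i j : Fin n) : omega n (v (w i)) (x (w j)) = omega n (v (w j)) (x (w i)) := by
    have h0 := M.omega_eq_zero (w i).2 (w j).2
    rw [← hvx (w i), ← hvx (w j)] at h0
    simp only [map_add, LinearMap.add_apply, L₁.omega_eq_zero (v (w i)).2 (v (w j)).2,
      L₂.omega_eq_zero (x (w i)).2 (x (w j)).2, omega_swap (v (w j) : E n) (x (w i))] at h0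
    linarith
  obtain ⟨g, R, hg⟩ := exists_sp_of_pos (b := fun i => v (w i)) (c := fun i => x (w i))
    (fun i j => L₁.omega_eq_zero (v (w i)).2 (v (w j)).2)
    (fun i j => L₂.omega_eq_zero (x (w i)).2 (x (w j)).2) hsymm fun z hz => by
      rw [hv, hx]
      exact hpos _ fun h0 => hz <|
        funext (Fintype.linearIndependent_iff.1 w.linearIndependent z h0)
  simp only [hv, hx] at hg
  refine ⟨g, smul_spanE_eq_iff.2 fun z => ?_, smul_spanD_eq_iff.2 fun z => ?_,
    smul_spanF_eq_iff.2 fun z => ?_⟩ <;> rw [hg]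
  · simp
  · simp [hvx]
  · simp

/-- The complex structure maps any Lagrangian to a transverse one, and `ω(x, J y) = x ⬝ᵥ y`. -/
instance : MulAction.IsPretransitive (Sp n) (Lag n) := by
  refine (MulAction.isPretransitive_iff_base (spanE n)).2 fun L => ?_
  have hJ (x y : E n) : omega n x ((SymplecticGroup.symJ (Fin n) ℝ).1.mulVec y) = x ⬝ᵥ y := by
    simp [omega_eq, SymplecticGroup.symJ, Matrix.J_squared, Matrix.neg_mulVec]
  let b := Module.finBasisOfFinrankEq ℝ L.1 L.2.1
  have hb (z : Fin n → ℝ) : Fintype.linearCombination ℝ (fun i => (b i : E n)) z =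
      Fintype.linearCombination ℝ b z := by
    simp [Fintype.linearCombination_apply]
  obtain ⟨g, R, hg⟩ := exists_sp_of_pos (b := fun i => (b i : E n))
    (c := fun i => (SymplecticGroup.symJ (Fin n) ℝ).1.mulVec (b i))
    (fun i j => L.omega_eq_zero (b i).2 (b j).2)
    (fun i j => (omega_mulVec _ _ _).trans (L.omega_eq_zero (b i).2 (b j).2))
    (fun i j => by rw [hJ, hJ, dotProduct_comm]) fun z hz => by
      have hlin : Fintype.linearCombination ℝ
          (fun i => (SymplecticGroup.symJ (Fin n) ℝ).1.mulVec (b i)) z =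
          (SymplecticGroup.symJ (Fin n) ℝ).1.mulVec (Fintype.linearCombination ℝ b z) := by
        simp [Fintype.linearCombination_apply, Matrix.mulVec_sum, Matrix.mulVec_smul]
      rw [hb, hlin, hJ]
      refine Matrix.dotProduct_star_self_pos_iff.2 fun h0 => hz ?_
      exact funext (Fintype.linearIndependent_iff.1 b.linearIndependent z (Subtype.ext h0))
  exact ⟨g, smul_spanE_eq_iff.2 fun z => by rw [hg, hb]; simp⟩

end NormalForm

/-! ### Orthogonal matrices -/

section Orthogonal

variable {n : ℕ}

theorem On.coe_inv (r : On n) : (r⁻¹ : On n).1 = r.1.transpose := rfl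

theorem On.coe_mul_coe_inv (r : On n) : r.1 * (r⁻¹ : On n).1 = 1 :=
  congrArg Subtype.val (mul_inv_cancel r)

theorem On.coe_inv_mul_coe (r : On n) : (r⁻¹ : On n).1 * r.1 = 1 :=
  congrArg Subtype.val (inv_mul_cancel r)

/-- The block diagonal embedding `r ↦ diag(r, r)` of `O(n)` in `Sp(2n, ℝ)`. -/
def orthSp (n : ℕ) : On n →* Sp n where
  toFun r := ⟨Matrix.fromBlocks r.1 0 0 r.1, by
    have h : r.1.transpose * r.1 = 1 := r.coe_inv_mul_coe
    rw [SymplecticGroup.fromBlocks_mem_iff]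
    simp [h]⟩
  map_one' := Subtype.ext (by simp)
  map_mul' r s := Subtype.ext (by simp [Matrix.fromBlocks_multiply])

theorem orthSp_coe (r : On n) : (orthSp n r).1 = Matrix.fromBlocks r.1 0 0 r.1 := rfl

theorem mem_range_orthSp_iff {g : Sp n} : g ∈ (orthSp n).range ↔
    g • spanE n = spanE n ∧ g • spanD n = spanD n ∧ g • spanF n = spanF n := by
  rw [smul_spanE_eq_spanE_iff, smul_spanD_eq_spanD_iff, smul_spanF_eq_spanF_iff]
  constructor
  · rintro ⟨r, rfl⟩
    simp [orthSp_coe]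
  · rintro ⟨hE, hD, hF⟩
    have hone := toBlocks_transpose_mul_sub_eq_one g
    rw [hE, hF, add_zero, zero_add] at hD
    rw [hF, ← hD, Matrix.mul_zero, sub_zero] at hone
    refine ⟨⟨g.1.toBlocks₁₁, (Matrix.mem_orthogonalGroup_iff' _ _).2 hone⟩, Subtype.ext ?_⟩
    conv_rhs => rw [← Matrix.fromBlocks_toBlocks g.1, hE, hF, ← hD]
    rfl

theorem orthSp_mul_triMatrix_mul_orthSp (r s u : On n) :
    orthSp n r * triMatrix u * orthSp n s = triMatrix (r * u * s) :=
  Subtype.ext (by simp [triMatrix, orthSp_coe, Matrix.fromBlocks_multiply])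

theorem toBlocks₂₁_orthSp_mul_mul_orthSp (r s : On n) (g : Sp n) :
    (orthSp n r * g * orthSp n s).1.toBlocks₂₁ = r.1 * g.1.toBlocks₂₁ * s.1 := by
  change ((orthSp n r).1 * g.1 * (orthSp n s).1).toBlocks₂₁ = _
  rw [← Matrix.fromBlocks_toBlocks g.1]
  simp [orthSp_coe, Matrix.fromBlocks_multiply]

theorem triMatrix_smul_spanE (u : On n) : triMatrix u • spanE n = spanD n := by
  have h : triMatrix u = orthSp n u * triMatrix 1 := by
    simpa using (orthSp_mul_triMatrix_mul_orthSp u 1 1).symm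
  rw [h, mul_smul]
  exact (mem_range_orthSp_iff.1 ⟨u, rfl⟩).2.1

theorem triMatrix_smul_spanF (u : On n) : triMatrix u • spanF n = spanE n :=
  smul_spanF_of_block rfl

theorem triMatrix_one_smul_spanD : triMatrix (1 : On n) • spanD n = spanF n := by
  refine smul_spanD_eq_iff.2 fun z => ?_
  simp [mulVec_elim, triMatrix, elim_mem_spanF_iff, Matrix.neg_mulVec]

theorem exists_eq_triMatrix {g : Sp n} (hE : g • spanE n = spanD n) (hD : g • spanD n = spanF n)
    (hF : g • spanF n = spanE n) : ∃ u, g = triMatrix u := by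
  have hmem : g * (triMatrix 1)⁻¹ ∈ (orthSp n).range := by
    refine mem_range_orthSp_iff.2 ⟨?_, ?_, ?_⟩ <;> rw [mul_smul]
    · rw [inv_smul_eq_iff.2 (triMatrix_smul_spanF 1).symm, hF]
    · rw [inv_smul_eq_iff.2 (triMatrix_smul_spanE 1).symm, hE]
    · rw [inv_smul_eq_iff.2 triMatrix_one_smul_spanD.symm, hD]
  obtain ⟨r, hr⟩ := hmem
  refine ⟨r, ?_⟩
  rw [← mul_one r, ← mul_one (r * 1), ← orthSp_mul_triMatrix_mul_orthSp, hr]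
  simp

theorem triMatrix_injective : Function.Injective (triMatrix (n := n)) := fun _ _ h =>
  Subtype.ext (Matrix.fromBlocks_inj.1 (congrArg Subtype.val h)).1

end Orthogonal

/-! ### The singular value decomposition -/

section SingularValues

variable {n : ℕ}

theorem exists_orthogonal_diagonalization {P : Matrix (Fin n) (Fin n) ℝ} (hP : P.IsHermitian) :
    ∃ (r : On n) (d : Fin n → ℝ), Monotone d ∧ r.1 * P * (r⁻¹ : On n).1 = Matrix.diagonal d := by
  let U : Matrix (Fin n) (Fin n) ℝ := hP.eigenvectorUnitary.1
  let σ := Tuple.sort hP.eigenvalues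
  have hU : star U * U = 1 := Unitary.coe_star_mul_self hP.eigenvectorUnitary
  have hUP : star U * P * U = Matrix.diagonal hP.eigenvalues := by
    have h := hP.conjStarAlgAut_star_eigenvectorUnitary
    rw [Unitary.conjStarAlgAut_star_apply] at h
    exact h
  have hsub (A : Matrix (Fin n) (Fin n) ℝ) :
      (star U).submatrix σ id * A * U.submatrix id σ = (star U * A * U).submatrix σ σ := by
    rw [Matrix.submatrix_mul (star U * A) U σ id σ Function.bijective_id,
      Matrix.submatrix_mul (star U) A σ id id Function.bijective_id, Matrix.submatrix_id_id]
  have hstar : ((star U).submatrix σ id).transpose = U.submatrix id σ := rfl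
  refine ⟨⟨(star U).submatrix σ id, (Matrix.mem_orthogonalGroup_iff _ _).2 ?_⟩,
    hP.eigenvalues ∘ σ, Tuple.monotone_sort _, ?_⟩
  · have hone := hsub 1
    rwa [Matrix.mul_one, Matrix.mul_one, hU, Matrix.submatrix_one_equiv, ← hstar] at hone
  · have hdiag := hsub P
    rwa [hUP, Matrix.submatrix_diagonal_equiv, ← hstar] at hdiag

/-- The polar decomposition, with orthogonal factor `|C|⁻¹ Cᵀ` for `|C| = √(Cᵀ C)`. -/
theorem exists_orthogonal_mul_posDef {C : Matrix (Fin n) (Fin n) ℝ} (hC : IsUnit C) :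
    ∃ u : On n, (u.1 * C).PosDef := by
  have hP : (C.transpose * C).PosDef := by
    simpa using Matrix.PosDef.conjTranspose_mul_self C (Matrix.mulVec_injective_of_isUnit hC)
  set P := C.transpose * C with hPdef
  refine ⟨⟨(CFC.sqrt P)⁻¹ * C.transpose, (Matrix.mem_orthogonalGroup_iff _ _).2 ?_⟩, ?_⟩
  · change _ * ((CFC.sqrt P)⁻¹ * C.transpose).transpose = 1
    rw [Matrix.transpose_mul, Matrix.transpose_transpose, inv_sqrt_transpose, Matrix.mul_assoc,
      ← Matrix.mul_assoc C.transpose, ← Matrix.mul_assoc, inv_sqrt_mul_self_mul_inv_sqrt hP]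
  · have hsqrt : (CFC.sqrt P)⁻¹ * C.transpose * C = CFC.sqrt P := by
      rw [Matrix.mul_assoc, ← hPdef]
      nth_rewrite 2 [← sqrt_mul_sqrt hP]
      exact Matrix.nonsing_inv_mul_cancel_left _ _ (sqrt_isUnit_det hP)
    change ((CFC.sqrt P)⁻¹ * C.transpose * C).PosDef
    rw [hsqrt]
    exact Matrix.isStrictlyPositive_iff_posDef.1 hP.isStrictlyPositive.sqrt

theorem exists_singular_value_decomposition {C : Matrix (Fin n) (Fin n) ℝ} (hC : IsUnit C) :
    ∃ s r : On n, s.1 * C * (r⁻¹ : On n).1 ∈ Delta n := by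
  obtain ⟨u, hu⟩ := exists_orthogonal_mul_posDef hC
  obtain ⟨r, d, hd, hr⟩ := exists_orthogonal_diagonalization hu.isHermitian
  have hpos : (Matrix.diagonal d).PosDef := by
    rw [← hr]
    have hrow : Function.Injective r.1.vecMul :=
      Matrix.vecMul_injective_of_isUnit (IsUnit.of_mul_eq_one _ r.coe_mul_coe_inv)
    have h := hu.mul_mul_conjTranspose_same hrow
    rwa [Matrix.conjTranspose_eq_transpose_of_trivial] at h
  refine ⟨r * u, r, d, Matrix.posDef_diagonal_iff.1 hpos, hd, ?_⟩
  rw [← hr]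
  simp only [Submonoid.coe_mul, Matrix.mul_assoc]

end SingularValues

/-! ### Edge matrices -/

section EdgeMatrix

variable {n : ℕ}

theorem mem_Delta_iff {D : Matrix (Fin n) (Fin n) ℝ} :
    D ∈ Delta n ↔ D.IsDiag ∧ (∀ i, 0 < D i i) ∧ Monotone D.diag := by
  constructor
  · rintro ⟨d, hd, hmono, rfl⟩
    exact ⟨Matrix.isDiag_diagonal d, by simpa using hd, by simpa using hmono⟩
  · rintro ⟨hdiag, hpos, hmono⟩
    exact ⟨D.diag, hpos, hmono, hdiag.diagonal_diag.symm⟩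

theorem posDef_of_mem_Delta {D : Matrix (Fin n) (Fin n) ℝ} (hD : D ∈ Delta n) : D.PosDef := by
  obtain ⟨d, hd, -, rfl⟩ := hD
  exact Matrix.posDef_diagonal_iff.2 hd

theorem sqrt_diagonal {d : Fin n → ℝ} (hd : ∀ i, 0 ≤ d i) :
    CFC.sqrt (Matrix.diagonal d) = Matrix.diagonal fun i => √(d i) := by
  refine CFC.sqrt_unique ?_ (Matrix.nonneg_iff_posSemidef.2
    (Matrix.posSemidef_diagonal_iff.2 fun i => Real.sqrt_nonneg _))
  simp only [Matrix.diagonal_mul_diagonal, Real.mul_self_sqrt (hd _)]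

theorem sqrt_mem_Delta {D : Matrix (Fin n) (Fin n) ℝ} (hD : D ∈ Delta n) :
    CFC.sqrt D ∈ Delta n := by
  obtain ⟨d, hd, hmono, rfl⟩ := hD
  exact ⟨_, fun i => Real.sqrt_pos.2 (hd i), fun i j hij => Real.sqrt_le_sqrt (hmono hij),
    sqrt_diagonal fun i => (hd i).le⟩

theorem mul_self_mem_Delta {D : Matrix (Fin n) (Fin n) ℝ} (hD : D ∈ Delta n) :
    D * D ∈ Delta n := by
  obtain ⟨d, hd, hmono, rfl⟩ := hD
  exact ⟨_, fun i => mul_pos (hd i) (hd i),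
    fun i j hij => mul_self_le_mul_self (hd i).le (hmono hij), Matrix.diagonal_mul_diagonal _ _⟩

theorem sqrt_mul_self_of_mem_Delta {D : Matrix (Fin n) (Fin n) ℝ} (hD : D ∈ Delta n) :
    CFC.sqrt (D * D) = D :=
  CFC.sqrt_mul_self D (posDef_of_mem_Delta hD).posSemidef.nonneg

theorem transpose_toBlocks₂₁_mul_toBlocks₁₂ {g : Sp n} (hE : g • spanE n = spanF n) :
    g.1.toBlocks₂₁.transpose * -g.1.toBlocks₁₂ = 1 := by
  have h := toBlocks_transpose_mul_sub_eq_one g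
  rwa [smul_spanE_eq_spanF_iff.1 hE, Matrix.transpose_zero, Matrix.zero_mul, zero_sub,
    ← Matrix.mul_neg] at h

theorem isUnit_toBlocks₂₁ {g : Sp n} (hE : g • spanE n = spanF n) : IsUnit g.1.toBlocks₂₁ :=
  (Matrix.isUnit_transpose _).1 (IsUnit.of_mul_eq_one _ (transpose_toBlocks₂₁_mul_toBlocks₁₂ hE))

theorem eq_of_toBlocks₂₁_eq {g g' : Sp n} (hE : g • spanE n = spanF n)
    (hF : g • spanF n = spanE n) (hE' : g' • spanE n = spanF n) (hF' : g' • spanF n = spanE n)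
    (h : g.1.toBlocks₂₁ = g'.1.toBlocks₂₁) : g = g' := by
  have h₁₂ := Matrix.inv_eq_right_inv (transpose_toBlocks₂₁_mul_toBlocks₁₂ hE)
  rw [h, Matrix.inv_eq_right_inv (transpose_toBlocks₂₁_mul_toBlocks₁₂ hE'), neg_inj] at h₁₂
  refine Subtype.ext (Matrix.ext_iff_blocks.2 ⟨?_, h₁₂.symm, h, ?_⟩)
  · rw [smul_spanE_eq_spanF_iff.1 hE, smul_spanE_eq_spanF_iff.1 hE']
  · rw [smul_spanF_eq_spanE_iff.1 hF, smul_spanF_eq_spanE_iff.1 hF']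

theorem toBlocks₂₁_inv (g : Sp n) : (g⁻¹).1.toBlocks₂₁ = -g.1.toBlocks₂₁.transpose := by
  rw [SymplecticGroup.coe_inv]
  nth_rewrite 1 [← Matrix.fromBlocks_toBlocks g.1]
  simp [Matrix.J, Matrix.fromBlocks_transpose, Matrix.fromBlocks_neg, Matrix.fromBlocks_multiply]

end EdgeMatrix

/-! ### Topology of the Lagrangian Grassmannian -/

section HomogeneousSpace

open Topology Pointwise

variable {G X : Type*} [Group G] [TopologicalSpace G] [MulAction G X] [TopologicalSpace X] {x : X}

theorem isOpenQuotientMap_smul_of_isQuotientMap [ContinuousMul G]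
    (h : IsQuotientMap fun g : G => g • x) : IsOpenQuotientMap fun g : G => g • x := by
  refine ⟨h.surjective, h.continuous, fun U hU => h.isOpen_preimage.1 ?_⟩
  have hpre : (fun g : G => g • x) ⁻¹' ((fun g : G => g • x) '' U) =
      U * (MulAction.stabilizer G x : Set G) := by
    ext g
    constructor
    · rintro ⟨h, hU, hgh⟩
      refine Set.mem_mul.2 ⟨h, hU, h⁻¹ * g, ?_, mul_inv_cancel_left h g⟩
      exact (mul_smul _ _ _).trans (inv_smul_eq_iff.2 hgh.symm)
    · rintro ⟨h, hU, s, hs, rfl⟩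
      exact ⟨h, hU, ((mul_smul h s x).trans (congrArg _ hs)).symm⟩
  rw [hpre]
  exact hU.mul_right

theorem continuousSMul_of_isOpenQuotientMap_smul [ContinuousMul G]
    (h : IsOpenQuotientMap fun g : G => g • x) : ContinuousSMul G X where
  continuous_smul := by
    rw [← (IsOpenQuotientMap.id.prodMap h).continuous_comp_iff]
    exact (h.continuous.comp continuous_mul).congr fun p => mul_smul p.1 p.2 x

theorem t2Space_of_isOpenQuotientMap_smul [IsTopologicalGroup G]
    (h : IsOpenQuotientMap fun g : G => g • x) (hx : IsClosed {g : G | g • x = x}) :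
    T2Space X := by
  rw [t2Space_iff_of_isOpenQuotientMap h]
  convert hx.preimage (f := fun p : G × G => p.1⁻¹ * p.2) (by fun_prop) using 1
  ext p
  simp only [Set.mem_ofPred_eq, Set.mem_preimage, mul_smul, inv_smul_eq_iff]
  exact eq_comm

end HomogeneousSpace

section Grassmannian

open Topology

variable {n : ℕ}

instance : IsTopologicalGroup (Sp n) where
  continuous_inv := by
    refine continuous_induced_rng.2 ?_
    change Continuous fun g : Sp n => -Matrix.J (Fin n) ℝ * g.1.transpose * Matrix.J (Fin n) ℝ
    fun_prop

theorem isOpenQuotientMap_smul_spanE (n : ℕ) : IsOpenQuotientMap fun g : Sp n => g • spanE n :=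
  isOpenQuotientMap_smul_of_isQuotientMap ⟨⟨rfl⟩, MulAction.surjective_smul (Sp n) (spanE n)⟩

instance : ContinuousSMul (Sp n) (Lag n) :=
  continuousSMul_of_isOpenQuotientMap_smul (isOpenQuotientMap_smul_spanE n)

instance : T2Space (Lag n) := by
  refine t2Space_of_isOpenQuotientMap_smul (isOpenQuotientMap_smul_spanE n) ?_
  simp only [smul_spanE_eq_spanE_iff]
  exact isClosed_eq (continuous_subtype_val.matrix_submatrix _ _) continuous_const

theorem isOpenMap_smul_lag (L : Lag n) : IsOpenMap fun g : Sp n => g • L := by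
  obtain ⟨h, rfl⟩ := MulAction.exists_smul_eq (Sp n) (spanE n) L
  simp only [← mul_smul]
  exact (isOpenQuotientMap_smul_spanE n).isOpenMap.comp (isOpenMap_mul_right h)

theorem Lag.eventually_forall_nonneg {L₀ : Lag n} {q : E n → ℝ} (hq : Continuous q)
    (hsmul : ∀ (c : ℝ) v, q (c • v) = c ^ 2 * q v) (hpos : ∀ v ∈ L₀.1, v ≠ 0 → 0 < q v) :
    ∀ᶠ L in 𝓝 L₀, ∀ v ∈ L.1, 0 ≤ q v := by
  have hcompact : IsCompact (Metric.sphere (0 : E n) 1 ∩ L₀.1) :=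
    (isCompact_sphere _ _).inter_right L₀.1.closed_of_finiteDimensional
  have hcont : Continuous fun p : Sp n × E n => q (p.1.1.mulVec p.2) := by fun_prop
  have hev : ∀ᶠ g in 𝓝 (1 : Sp n), ∀ v ∈ Metric.sphere (0 : E n) 1 ∩ L₀.1,
      0 < q (g.1.mulVec v) := by
    refine hcompact.eventually_forall_of_forall_eventually fun v ⟨hv, hvL⟩ => ?_
    refine (isOpen_lt continuous_const hcont).mem_nhds ?_
    simpa using hpos v hvL (ne_zero_of_mem_unit_sphere ⟨v, hv⟩)
  have himage := (isOpenMap_smul_lag L₀).image_mem_nhds hev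
  rw [one_smul] at himage
  refine Filter.mem_of_superset himage ?_
  rintro _ ⟨g, hg, rfl⟩ _ ⟨v, hv, rfl⟩
  change 0 ≤ q (g.1.mulVec v)
  obtain rfl | hne := eq_or_ne v 0
  · simpa using (hsmul 0 0).ge
  have hunit := hg (‖v‖⁻¹ • v) ⟨by simp [norm_smul, hne], L₀.1.smul_mem _ hv⟩
  rw [Matrix.mulVec_smul, hsmul] at hunit
  exact (pos_of_mul_pos_right hunit (sq_nonneg _)).le

theorem Lag.eventually_forall_dotProduct_le {ι κ : Type*} [Fintype ι] [Fintype κ] {L₀ : Lag n}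
    {α : E n →ₗ[ℝ] ι → ℝ} {β : E n →ₗ[ℝ] κ → ℝ} (hα : ∀ v ∈ L₀.1, α v = 0 → v = 0)
    (hβ : ∀ v ∈ L₀.1, β v = 0) (c : ℝ) :
    ∀ᶠ L in 𝓝 L₀, ∀ v ∈ L.1, c * (β v ⬝ᵥ β v) ≤ α v ⬝ᵥ α v := by
  have hαc := α.continuous_of_finiteDimensional
  have hβc := β.continuous_of_finiteDimensional
  refine (Lag.eventually_forall_nonneg (q := fun v => α v ⬝ᵥ α v - c * (β v ⬝ᵥ β v)) (by fun_prop)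
    (fun c v => ?_) fun v hv hne => ?_).mono fun L hL v hv => sub_nonneg.1 (hL v hv)
  · simp only [map_smul, smul_dotProduct, dotProduct_smul, smul_eq_mul]
    ring
  · simpa [hβ v hv] using Matrix.dotProduct_star_self_pos_iff.2 (mt (hα v hv) hne)

end Grassmannian

/-! ### Properness of the action on positive triples -/

section ProperAction

open Topology

variable {n : ℕ}

/-- For `(p, r)` and `(q, s)` the images of `(z, 0)` and `(0, z)`, the hypotheses say that the
image of the standard triple is close to the standard triple. -/
theorem dotProduct_self_le_of_near {p q r s : Fin n → ℝ} (hr : 20 * (r ⬝ᵥ r) ≤ p ⬝ᵥ p)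
    (hq : 20 * (q ⬝ᵥ q) ≤ s ⬝ᵥ s)
    (ht : 20 * ((r + s - (p + q)) ⬝ᵥ (r + s - (p + q))) ≤ (p + q) ⬝ᵥ (p + q)) :
    p ⬝ᵥ p ≤ 4 * (p ⬝ᵥ s - r ⬝ᵥ q) ∧ q ⬝ᵥ q ≤ 4 * (p ⬝ᵥ s - r ⬝ᵥ q) ∧
      r ⬝ᵥ r ≤ 4 * (p ⬝ᵥ s - r ⬝ᵥ q) ∧ s ⬝ᵥ s ≤ 4 * (p ⬝ᵥ s - r ⬝ᵥ q) := by
  have nonneg (x : Fin n → ℝ) : 0 ≤ x ⬝ᵥ x := dotProduct_self_star_nonneg x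
  have h₁ := nonneg (p - q)
  have h₂ := nonneg (r - q)
  have h₃ := nonneg ((r + s - (p + q)) - q)
  have h₄ := nonneg ((r + s - (p + q)) + r)
  have h₅ := nonneg (q + r)
  have hp := nonneg p
  have hs := nonneg s
  simp only [add_dotProduct, dotProduct_add, sub_dotProduct, dotProduct_sub,
    dotProduct_comm q p, dotProduct_comm r p, dotProduct_comm s p, dotProduct_comm r q,
    dotProduct_comm s q, dotProduct_comm s r] at *
  refine ⟨?_, ?_, ?_, ?_⟩ <;> linarith

theorem abs_le_of_dotProduct_mulVec_self_le {ι κ : Type*} [Fintype ι] [Fintype κ]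
    {A : Matrix ι κ ℝ} {c : ℝ} (hc : 0 ≤ c)
    (h : ∀ z, A.mulVec z ⬝ᵥ A.mulVec z ≤ c ^ 2 * (z ⬝ᵥ z)) (i : ι) (j : κ) : |A i j| ≤ c := by
  classical
  have hcol := h (Pi.single j 1)
  simp only [Matrix.mulVec_single_one, dotProduct_single, Pi.single_eq_same, mul_one] at hcol
  refine abs_le_of_sq_le_sq (le_trans ?_ hcol) hc
  rw [sq]
  exact Finset.single_le_sum (f := fun i => A i j * A i j) (fun i _ => mul_self_nonneg _)
    (Finset.mem_univ i)

theorem isCompact_setOf_abs_le (n : ℕ) (c : ℝ) : IsCompact {g : Sp n | ∀ i j, |g.1 i j| ≤ c} := by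
  have hclosed : IsClosed (Matrix.symplecticGroup (Fin n) ℝ :
      Set (Matrix (Fin n ⊕ Fin n) (Fin n ⊕ Fin n) ℝ)) := by
    change IsClosed {A | A * Matrix.J (Fin n) ℝ * A.transpose = Matrix.J (Fin n) ℝ}
    exact isClosed_eq (by fun_prop) continuous_const
  have hcompact : IsCompact {A : Matrix (Fin n ⊕ Fin n) (Fin n ⊕ Fin n) ℝ |
      ∀ i j, |A i j| ≤ c} := by
    have h := isCompact_univ_pi fun _ : Fin n ⊕ Fin n =>
      isCompact_univ_pi fun _ : Fin n ⊕ Fin n => isCompact_Icc (a := -c) (b := c)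
    simp only [Set.pi, Set.mem_univ, true_imp_iff, Set.mem_ofPred_eq, Set.mem_Icc, ← abs_le] at h
    exact h
  exact hclosed.isClosedEmbedding_subtypeVal.isCompact_preimage hcompact

theorem abs_le_two_of_near {g : Sp n}
    (hE : ∀ x y : Fin n → ℝ, (Sum.elim x y : E n) ∈ (g • spanE n).1 → 20 * (y ⬝ᵥ y) ≤ x ⬝ᵥ x)
    (hD : ∀ x y : Fin n → ℝ, (Sum.elim x y : E n) ∈ (g • spanD n).1 →
      20 * ((y - x) ⬝ᵥ (y - x)) ≤ x ⬝ᵥ x)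
    (hF : ∀ x y : Fin n → ℝ, (Sum.elim x y : E n) ∈ (g • spanF n).1 → 20 * (x ⬝ᵥ x) ≤ y ⬝ᵥ y) :
    ∀ i j, |g.1 i j| ≤ 2 := by
  have hsum (z : Fin n → ℝ) :
      g.1.toBlocks₁₁.mulVec z ⬝ᵥ g.1.toBlocks₂₂.mulVec z -
        g.1.toBlocks₂₁.mulVec z ⬝ᵥ g.1.toBlocks₁₂.mulVec z = z ⬝ᵥ z := by
    have h := omega_mulVec g (Sum.elim z 0) (Sum.elim 0 z)
    simpa [mulVec_elim, omega_apply] using h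
  have bound (z : Fin n → ℝ) := dotProduct_self_le_of_near
    (hE _ _ (by simpa [mulVec_elim] using smul_spanE_eq_iff.1 (Eq.refl (g • spanE n)) z))
    (hF _ _ (by simpa [mulVec_elim] using smul_spanF_eq_iff.1 (Eq.refl (g • spanF n)) z))
    (hD _ _ (by simpa [mulVec_elim] using smul_spanD_eq_iff.1 (Eq.refl (g • spanD n)) z))
  simp only [hsum, show (4 : ℝ) = 2 ^ 2 by norm_num] at bound
  rintro (i | i) (j | j)
  · exact abs_le_of_dotProduct_mulVec_self_le zero_le_two (fun z => (bound z).1) i j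
  · exact abs_le_of_dotProduct_mulVec_self_le zero_le_two (fun z => (bound z).2.1) i j
  · exact abs_le_of_dotProduct_mulVec_self_le zero_le_two (fun z => (bound z).2.2.1) i j
  · exact abs_le_of_dotProduct_mulVec_self_le zero_le_two (fun z => (bound z).2.2.2) i j

theorem exists_isCompact_eventually_mem_of_smul_eq (n : ℕ) : ∃ K : Set (Sp n), IsCompact K ∧
    ∀ᶠ p in 𝓝 (spanE n, spanD n, spanF n), ∀ g : Sp n,
      g • (spanE n, spanD n, spanF n) = p → g ∈ K := by
  let x : E n →ₗ[ℝ] Fin n → ℝ := LinearMap.funLeft ℝ ℝ Sum.inl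
  let y : E n →ₗ[ℝ] Fin n → ℝ := LinearMap.funLeft ℝ ℝ Sum.inr
  have hx (u v : Fin n → ℝ) : x (Sum.elim u v : E n) = u := rfl
  have hy (u v : Fin n → ℝ) : y (Sum.elim u v : E n) = v := rfl
  have hE := Lag.eventually_forall_dotProduct_le (L₀ := spanE n) (α := x) (β := y)
    (by simp +contextual [mem_spanE_iff_exists, hx])
    (by simp [mem_spanE_iff_exists, hy]) 20
  have hF := Lag.eventually_forall_dotProduct_le (L₀ := spanF n) (α := y) (β := x)
    (by simp +contextual [mem_spanF_iff_exists, hy])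
    (by simp [mem_spanF_iff_exists, hx]) 20
  have hD := Lag.eventually_forall_dotProduct_le (L₀ := spanD n) (α := x) (β := y - x)
    (by simp +contextual [mem_spanD_iff_exists, hx])
    (by simp [mem_spanD_iff_exists, hx, hy]) 20
  refine ⟨_, isCompact_setOf_abs_le n 2, ?_⟩
  filter_upwards [hE.prod_nhds (hD.prod_nhds hF)]
  rintro _ ⟨hE, hD, hF⟩ g rfl
  exact abs_le_two_of_near (fun _ _ => hE _) (fun _ _ => hD _) (fun _ _ => hF _)

end ProperAction

/-! ### Positivity is invariant under flips -/

section Flips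

variable {V : Type*} {T T' : IdealTriangulation V} {n : ℕ}

theorem IdealTriangulation.next_next_ne (T : IdealTriangulation V) (v : V) :
    T.next (T.next v) ≠ v := fun h => T.next_ne v (by rw [← h, T.next_next_next, h])

theorem IdealTriangulation.IsFlip.opp {v : V} (h : IdealTriangulation.IsFlip T T' v) :
    IdealTriangulation.IsFlip T T' (T.opp v) where
  internal := by simpa only [T.opp_opp] using h.internal.symm
  ne_next hv := by
    rw [T.opp_opp] at hv
    have hw := congrArg (fun u => T.next (T.next u)) hv
    rw [T.next_next_next] at hw
    exact h.ne_next_next hw.symm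
  ne_next_next hv := by
    rw [T.opp_opp] at hv
    have hw := congrArg T.next hv
    rw [T.next_next_next] at hw
    exact h.ne_next hw.symm
  opp_eq := h.opp_eq
  next_v := h.next_w
  next_b := by simpa only [T.opp_opp] using h.next_d
  next_c := by simpa only [T.opp_opp] using h.next_a
  next_w := by simpa only [T.opp_opp] using h.next_v
  next_d := by simpa only [T.opp_opp] using h.next_b
  next_a := by simpa only [T.opp_opp] using h.next_c
  next_other u h₁ h₂ h₃ h₄ h₅ h₆ := by
    rw [T.opp_opp] at h₄ h₅ h₆
    exact h.next_other u h₄ h₅ h₆ h₁ h₂ h₃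

namespace FramedLocalSystem

variable {F : FramedLocalSystem T n} {F' : FramedLocalSystem T' n}

theorem IsFlip.opp {v : V} (h : F.IsFlip F' v) : F.IsFlip F' (T.opp v) where
  flip := h.flip.opp
  edge_eq u h₁ h₂ hv hw := h.edge_eq u h₁ h₂ (by rwa [T.opp_opp] at hw) hv
  tri_eq u h₁ h₂ h₃ h₄ h₅ h₆ := by
    rw [T.opp_opp] at h₄ h₅ h₆
    exact h.tri_eq u h₄ h₅ h₆ h₁ h₂ h₃
  Lt_eq u hv hw := h.Lt_eq u (by rwa [T.opp_opp] at hw) hv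
  Lb_eq u hv hw := h.Lb_eq u (by rwa [T.opp_opp] at hw) hv
  corner_b := by simpa only [rev, T.opp_opp] using h.corner_d
  corner_d := by simpa only [rev, T.opp_opp] using h.corner_b
  corner_a := by simpa only [rev, h.flip.opp_eq, T.opp_opp] using h.corner_c
  corner_c := by simpa only [rev, h.flip.opp_eq, T.opp_opp] using h.corner_a

/-- The Lagrangians at the vertices of the face of `v`, transported to the fibre at `T.next v`, form
a positive triple. -/
def IsPositiveAt (F : FramedLocalSystem T n) (v : V) : Prop :=
  PosTriple (F.Lt (T.next v)) (F.tri v • F.Lt v) (F.Lb (T.next v))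

theorem allMaslovMaximal_iff : F.AllMaslovMaximal ↔ ∀ v, F.IsPositiveAt v :=
  forall_congr' fun _ => maslovIndex_eq_iff_posTriple

theorem tri_smul_tri_smul_Lt (F : FramedLocalSystem T n) (v : V) :
    F.tri (T.next v) • F.tri v • F.Lt v = F.Lb (T.next (T.next v)) := by
  have h : (F.tri (T.next (T.next v)) * F.tri (T.next v) * F.tri v) • F.Lt v = F.Lt v := by
    refine Lag.smul_eq_of_forall fun x hx => ?_
    have hneg := congrArg (Matrix.mulVec · x) (F.tri_twisted v)
    rw [Matrix.neg_mulVec, Matrix.one_mulVec] at hneg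
    exact hneg ▸ neg_mem hx
  have h' := F.tri_Lb (T.next (T.next v))
  rw [T.next_next_next] at h'
  rw [← smul_left_cancel_iff (F.tri (T.next (T.next v))), h', ← mul_smul, ← mul_smul, h]

theorem IsPositiveAt.next {v : V} (h : F.IsPositiveAt v) : F.IsPositiveAt (T.next v) := by
  have hrot := (h.smul (F.tri (T.next v))).rotate.rotate
  rwa [tri_smul_tri_smul_Lt, F.tri_Lb] at hrot

theorem isPositiveAt_next_iff {v : V} : F.IsPositiveAt (T.next v) ↔ F.IsPositiveAt v :=
  ⟨fun h => T.next_next_next v ▸ h.next.next, IsPositiveAt.next⟩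

/-- The faces `(1, 2, 3)` and `(1, 3, 4)` being positive, so is the face `(2, 3, 4)` which contains
the other diagonal. -/
theorem IsPositiveAt.exchange {a : T.A₂} {c : V} (hc : T.next c = src a) (h : F.IsPositiveAt c)
    (h' : F.IsPositiveAt (tgt a)) :
    PosTriple (F.Lt (T.next (tgt a))) ((F.tri (tgt a) * F.edge a * F.tri c) • F.Lt c)
      (F.Lb (T.next (tgt a))) := by
  rw [IsPositiveAt, hc] at h
  have htransport := h.smul (F.tri (tgt a) * F.edge a)
  rw [mul_smul, F.edge_Lt, F.tri_Lb, mul_smul _ _ (F.Lb _), F.edge_Lb, ← mul_smul] at htransport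
  exact htransport.exchange h'

theorem IsFlip.isPositiveAt_self {v : V} (hf : F.IsFlip F' v) (h : ∀ u, F'.IsPositiveAt u) :
    F.IsPositiveAt v := by
  let a : T'.A₂ := ⟨v, hf.flip.internal'⟩
  have hsrc : src (rev a) = T.opp v := congrArg (· v) hf.flip.opp_eq
  have htgt : tgt (rev a) = v := T'.opp_opp v
  have hpos := (h (T.next v)).exchange (hf.flip.next_a.trans hsrc.symm) (h _)
  rw [htgt, ← hf.corner_a, hf.flip.next_v,
    hf.Lt_eq _ (T.next_next_ne v) hf.flip.ne_next_next.symm,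
    hf.Lb_eq _ (T.next_next_ne v) hf.flip.ne_next_next.symm,
    hf.Lt_eq _ (T.next_ne v) hf.flip.ne_next.symm] at hpos
  exact isPositiveAt_next_iff.1 hpos

theorem IsFlip.isPositiveAt {v : V} (hf : F.IsFlip F' v) (h : ∀ u, F'.IsPositiveAt u) (u : V) :
    F.IsPositiveAt u := by
  have hv := hf.isPositiveAt_self h
  have hw := hf.opp.isPositiveAt_self h
  by_cases h₁ : u = v; · rwa [h₁]
  by_cases h₂ : u = T.next v; · rwa [h₂, isPositiveAt_next_iff]
  by_cases h₃ : u = T.next (T.next v); · rwa [h₃, isPositiveAt_next_iff, isPositiveAt_next_iff]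
  by_cases h₄ : u = T.opp v; · rwa [h₄]
  by_cases h₅ : u = T.next (T.opp v); · rwa [h₅, isPositiveAt_next_iff]
  by_cases h₆ : u = T.next (T.next (T.opp v))
  · rwa [h₆, isPositiveAt_next_iff, isPositiveAt_next_iff]
  have hnv : T.next u ≠ v := fun hu => h₃ (by rw [← hu, T.next_next_next])
  have hnw : T.next u ≠ T.opp v := fun hu => h₆ (by rw [← hu, T.next_next_next])
  have hu := h u
  rwa [IsPositiveAt, hf.flip.next_other u h₁ h₂ h₃ h₄ h₅ h₆, hf.tri_eq u h₁ h₂ h₃ h₄ h₅ h₆,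
    hf.Lt_eq _ hnv hnw, hf.Lb_eq _ hnv hnw, hf.Lt_eq _ h₁ h₄] at hu

theorem isMaximal_iff : F.IsMaximal ↔ ∀ v, F.IsPositiveAt v := by
  refine ⟨fun ⟨p, hp, hmax⟩ => ?_,
    fun h => ⟨_, Relation.ReflTransGen.refl, allMaslovMaximal_iff.2 h⟩⟩
  suffices ∀ q, Relation.ReflTransGen (FlipStep n) q p → ∀ v, q.2.IsPositiveAt v from this _ hp
  intro q hq
  induction hq using Relation.ReflTransGen.head_induction_on with
  | refl => exact allMaslovMaximal_iff.1 hmax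
  | head hstep _ ih => exact hstep.choose_spec.isPositiveAt ih

end FramedLocalSystem

end Flips

/-! ### Change of trivialization -/

section Gauge

variable {V : Type*} {T : IdealTriangulation V} {n : ℕ}

theorem IdealTriangulation.tgt_rev (a : T.A₂) : tgt (rev a) = src a := T.opp_opp a.1

theorem IdealTriangulation.src_rev (a : T.A₂) : src (rev a) = tgt a := rfl

theorem IdealTriangulation.rev_rev (a : T.A₂) : rev (rev a) = a := Subtype.ext (T.opp_opp a.1)

theorem coe_conj_eq_neg_one {g : Sp n} (hg : g.1 = -1) (k : Sp n) : (k * g * k⁻¹).1 = -1 := by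
  change k.1 * g.1 * (k⁻¹).1 = -1
  rw [hg, mul_neg_one, neg_mul]
  exact congrArg (-·.1) (mul_inv_cancel k)

namespace FramedLocalSystem

/-- Change of the trivializations of the fibres by `ψ`, so that the orbits are the classes of
isomorphic systems. -/
instance : SMul (V → Sp n) (FramedLocalSystem T n) where
  smul ψ F :=
    { edge := fun a => ψ (tgt a) * F.edge a * (ψ (src a))⁻¹
      tri := fun v => ψ (T.next v) * F.tri v * (ψ v)⁻¹
      Lt := fun v => ψ v • F.Lt v
      Lb := fun v => ψ v • F.Lb v
      edge_twisted := fun a => by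
        rw [← coe_conj_eq_neg_one (g := F.edge (rev a) * F.edge a) (F.edge_twisted a) (ψ (src a)),
          ← Submonoid.coe_mul, tgt_rev, src_rev]
        congr 1
        group
      tri_twisted := fun v => by
        rw [← coe_conj_eq_neg_one (g := F.tri (T.next (T.next v)) * F.tri (T.next v) * F.tri v)
          (F.tri_twisted v) (ψ v), ← Submonoid.coe_mul, ← Submonoid.coe_mul, T.next_next_next]
        congr 1
        group
      edge_Lt := fun a => by rw [mul_smul, inv_smul_smul, mul_smul, F.edge_Lt]
      edge_Lb := fun a => by rw [mul_smul, inv_smul_smul, mul_smul, F.edge_Lb]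
      tri_Lb := fun v => by rw [mul_smul, inv_smul_smul, mul_smul, F.tri_Lb] }

theorem smul_edge (ψ : V → Sp n) (F : FramedLocalSystem T n) (a : T.A₂) :
    (ψ • F).edge a = ψ (tgt a) * F.edge a * (ψ (src a))⁻¹ := rfl

theorem smul_tri (ψ : V → Sp n) (F : FramedLocalSystem T n) (v : V) :
    (ψ • F).tri v = ψ (T.next v) * F.tri v * (ψ v)⁻¹ := rfl

theorem smul_Lt (ψ : V → Sp n) (F : FramedLocalSystem T n) (v : V) :
    (ψ • F).Lt v = ψ v • F.Lt v := rfl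

theorem smul_Lb (ψ : V → Sp n) (F : FramedLocalSystem T n) (v : V) :
    (ψ • F).Lb v = ψ v • F.Lb v := rfl

instance : MulAction (V → Sp n) (FramedLocalSystem T n) where
  one_smul F := by
    ext : 2 <;> simp [smul_edge, smul_tri, smul_Lt, smul_Lb]
  mul_smul ψ φ F := by
    ext : 2 <;> simp [smul_edge, smul_tri, smul_Lt, smul_Lb, mul_assoc, mul_smul]

theorem equivalent_iff {F F' : FramedLocalSystem T n} :
    F.Equivalent F' ↔ ∃ ψ : V → Sp n, ψ • F = F' := by
  constructor
  · rintro ⟨ψ, hedge, htri, hLt, hLb⟩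
    exact ⟨ψ, FramedLocalSystem.ext (funext fun a => mul_inv_eq_of_eq_mul (hedge a).symm)
      (funext fun v => mul_inv_eq_of_eq_mul (htri v).symm) (funext hLt) (funext hLb)⟩
  · rintro ⟨ψ, rfl⟩
    exact ⟨ψ, fun _ => inv_mul_cancel_right _ _, fun _ => inv_mul_cancel_right _ _,
      fun _ => rfl, fun _ => rfl⟩

theorem mk_eq_mk_iff {F F' : FramedLocalSystem T n} :
    (⟦F⟧ : Moduli T n) = ⟦F'⟧ ↔ ∃ ψ : V → Sp n, ψ • F = F' :=
  Quotient.eq.trans equivalent_iff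

theorem mk_smul (ψ : V → Sp n) (F : FramedLocalSystem T n) : (⟦ψ • F⟧ : Moduli T n) = ⟦F⟧ :=
  (mk_eq_mk_iff.2 ⟨ψ, rfl⟩).symm

theorem IsPositiveAt.smul {F : FramedLocalSystem T n} {v : V} (h : F.IsPositiveAt v)
    (ψ : V → Sp n) : (ψ • F).IsPositiveAt v := by
  have hpos := PosTriple.smul (ψ (T.next v)) h
  rwa [← inv_smul_smul (ψ v) (F.Lt v), ← mul_smul, ← mul_smul] at hpos

theorem mk_mem_maximalModuli_iff {F : FramedLocalSystem T n} :
    (⟦F⟧ : Moduli T n) ∈ maximalModuli T n ↔ F.IsMaximal := by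
  refine ⟨fun ⟨G, hG, hGF⟩ => ?_, fun h => ⟨F, h, rfl⟩⟩
  obtain ⟨ψ, rfl⟩ := mk_eq_mk_iff.1 hGF
  exact isMaximal_iff.2 fun v => (isMaximal_iff.1 hG v).smul ψ

theorem continuous_iff {X : Type*} [TopologicalSpace X] {f : X → FramedLocalSystem T n} :
    Continuous f ↔
      (∀ a, Continuous fun x => (f x).edge a) ∧ (∀ v, Continuous fun x => (f x).tri v) ∧
      (∀ v, Continuous fun x => (f x).Lt v) ∧ ∀ v, Continuous fun x => (f x).Lb v := by
  simp only [continuous_induced_rng, Function.comp_def, continuous_prodMk, continuous_pi_iff]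

@[fun_prop]
theorem continuous_edge (a : T.A₂) : Continuous fun F : FramedLocalSystem T n => F.edge a :=
  (continuous_iff.1 continuous_id).1 a

@[fun_prop]
theorem continuous_tri (v : V) : Continuous fun F : FramedLocalSystem T n => F.tri v :=
  (continuous_iff.1 continuous_id).2.1 v

@[fun_prop]
theorem continuous_Lt (v : V) : Continuous fun F : FramedLocalSystem T n => F.Lt v :=
  (continuous_iff.1 continuous_id).2.2.1 v

@[fun_prop]
theorem continuous_Lb (v : V) : Continuous fun F : FramedLocalSystem T n => F.Lb v :=
  (continuous_iff.1 continuous_id).2.2.2 v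

instance : ContinuousSMul (V → Sp n) (FramedLocalSystem T n) where
  continuous_smul := by
    refine continuous_iff.2 ⟨fun a => ?_, fun v => ?_, fun v => ?_, fun v => ?_⟩ <;>
      simp only [smul_edge, smul_tri, smul_Lt, smul_Lb] <;> fun_prop

theorem isOpenQuotientMap_mk :
    IsOpenQuotientMap (fun F : FramedLocalSystem T n => (⟦F⟧ : Moduli T n)) := by
  have h : setoid T n = MulAction.orbitRel (V → Sp n) (FramedLocalSystem T n) := by
    ext F F'
    exact Setoid.comm' _ |>.trans equivalent_iff
  change IsOpenQuotientMap (Quotient.mk (setoid T n))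
  rw [h]
  exact MulAction.isOpenQuotientMap_quotientMk

end FramedLocalSystem

end Gauge

/-! ### Standard framed systems -/

section Standard

variable {V : Type*} {T : IdealTriangulation V} {n : ℕ}

namespace FramedLocalSystem

variable {F : FramedLocalSystem T n}

/-- The triple of Lagrangians of each face, seen from each of its sides, is the standard triple
`(spanE n, spanD n, spanF n)`. -/
structure IsStandard (F : FramedLocalSystem T n) : Prop where
  Lt_eq : ∀ v, F.Lt v = spanE n
  Lb_eq : ∀ v, F.Lb v = spanF n
  tri_smul_spanE : ∀ v, F.tri v • spanE n = spanD n

theorem isStandard_holSystem (x : XPlus T n) : (holSystem T x).IsStandard :=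
  ⟨fun _ => rfl, fun _ => rfl, fun _ => triMatrix_smul_spanE _⟩

namespace IsStandard

theorem isPositiveAt (hF : F.IsStandard) (v : V) : F.IsPositiveAt v := by
  rw [IsPositiveAt, hF.Lt_eq, hF.Lt_eq, hF.Lb_eq, hF.tri_smul_spanE]
  exact posTriple_spanE_spanD_spanF n

theorem edge_smul_spanE (hF : F.IsStandard) (a : T.A₂) : F.edge a • spanE n = spanF n := by
  simpa only [hF.Lt_eq, hF.Lb_eq] using F.edge_Lt a

theorem edge_smul_spanF (hF : F.IsStandard) (a : T.A₂) : F.edge a • spanF n = spanE n := by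
  simpa only [hF.Lt_eq, hF.Lb_eq] using F.edge_Lb a

theorem tri_smul_spanF (hF : F.IsStandard) (v : V) : F.tri v • spanF n = spanE n := by
  simpa only [hF.Lt_eq, hF.Lb_eq] using F.tri_Lb v

theorem tri_smul_spanD (hF : F.IsStandard) (v : V) : F.tri v • spanD n = spanF n := by
  have h := F.tri_smul_tri_smul_Lt (T.next (T.next v))
  rwa [hF.Lt_eq, hF.Lb_eq, hF.tri_smul_spanE, T.next_next_next] at h

theorem eq_iff {F' : FramedLocalSystem T n} (hF : F.IsStandard) (hF' : F'.IsStandard) :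
    F = F' ↔ (∀ a, (F.edge a).1.toBlocks₂₁ = (F'.edge a).1.toBlocks₂₁) ∧
      ∀ v, F.tri v = F'.tri v := by
  refine ⟨fun h => h ▸ ⟨fun _ => rfl, fun _ => rfl⟩, fun ⟨hedge, htri⟩ => ?_⟩
  refine FramedLocalSystem.ext (funext fun a => ?_) (funext htri)
    (funext fun v => (hF.Lt_eq v).trans (hF'.Lt_eq v).symm)
    (funext fun v => (hF.Lb_eq v).trans (hF'.Lb_eq v).symm)
  exact eq_of_toBlocks₂₁_eq (hF.edge_smul_spanE a) (hF.edge_smul_spanF a) (hF'.edge_smul_spanE a)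
    (hF'.edge_smul_spanF a) (hedge a)

theorem exists_tri_eq (hF : F.IsStandard) (v : V) : ∃ u, F.tri v = triMatrix u :=
  exists_eq_triMatrix (hF.tri_smul_spanE v) (hF.tri_smul_spanD v) (hF.tri_smul_spanF v)

theorem smul_iff (hF : F.IsStandard) {ψ : V → Sp n} :
    (ψ • F).IsStandard ↔ ∀ v, ψ v ∈ (orthSp n).range := by
  have htri (v : V) (h : ψ v • spanE n = spanE n) :
      (ψ • F).tri v • spanE n = ψ (T.next v) • spanD n := by
    rw [smul_tri, mul_smul, mul_smul, inv_smul_eq_iff.2 h.symm, hF.tri_smul_spanE]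
  constructor
  · intro h v
    have hE (v : V) : ψ v • spanE n = spanE n := hF.Lt_eq v ▸ h.Lt_eq v
    have hD := h.tri_smul_spanE (T.next (T.next v))
    rw [htri _ (hE _), T.next_next_next] at hD
    exact mem_range_orthSp_iff.2 ⟨hE v, hD, hF.Lb_eq v ▸ h.Lb_eq v⟩
  · intro h
    have h' (v : V) := mem_range_orthSp_iff.1 (h v)
    refine ⟨fun v => ?_, fun v => ?_, fun v => (htri v (h' v).1).trans (h' _).2.1⟩
    · rw [smul_Lt, hF.Lt_eq, (h' v).1]
    · rw [smul_Lb, hF.Lb_eq, (h' v).2.2]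

end IsStandard

theorem exists_isStandard_smul (hF : ∀ v, F.IsPositiveAt v) :
    ∃ ψ : V → Sp n, (ψ • F).IsStandard := by
  have hframe (v : V) : ∃ g : Sp n, g • spanE n = F.Lt v ∧
      g • spanD n = F.tri (T.next (T.next v)) • F.Lt (T.next (T.next v)) ∧
      g • spanF n = F.Lb v := by
    have h := (hF (T.next (T.next v))).exists_sp
    rwa [T.next_next_next] at h
  choose g hE hD hF using hframe
  refine ⟨g⁻¹, fun v => ?_, fun v => ?_, fun v => ?_⟩
  · rw [smul_Lt, Pi.inv_apply, inv_smul_eq_iff, hE]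
  · rw [smul_Lb, Pi.inv_apply, inv_smul_eq_iff, hF]
  · rw [smul_tri, Pi.inv_apply, Pi.inv_apply, inv_inv, mul_smul, mul_smul, hE, inv_smul_eq_iff, hD,
      T.next_next_next]

theorem toBlocks₂₁_edge_rev (F : FramedLocalSystem T n) (a : T.A₂) :
    (F.edge (rev a)).1.toBlocks₂₁ = (F.edge a).1.toBlocks₂₁.transpose := by
  have h : (F.edge (rev a)).1 = -((F.edge a)⁻¹).1 := by
    have hinv : (F.edge a).1 * ((F.edge a)⁻¹).1 = 1 :=
      congrArg Subtype.val (mul_inv_cancel (F.edge a))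
    rw [← neg_one_mul, ← F.edge_twisted a, Matrix.mul_assoc, hinv, Matrix.mul_one]
  rw [h, ← neg_neg (F.edge a).1.toBlocks₂₁.transpose, ← toBlocks₂₁_inv]
  rfl

/-- Both orientations of an internal edge are treated at once: the choice of one of them, here with
respect to a linear order of `V`, fixes the singular value decomposition that is used. -/
theorem exists_orthogonal_edge_mem_Delta {C : T.A₂ → Matrix (Fin n) (Fin n) ℝ}
    (hC : ∀ a, IsUnit (C a)) (hrev : ∀ a, C (rev a) = (C a).transpose) :
    ∃ r : V → On n, ∀ a, (r (tgt a)).1 * C a * ((r (src a))⁻¹ : On n).1 ∈ Delta n := by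
  classical
  let : LinearOrder V := IsWellOrder.linearOrder WellOrderingRel
  choose s r hsr using fun a => exists_singular_value_decomposition (hC a)
  let ρ (v : V) : On n := if h : T.opp v = v then 1 else
    if v < T.opp v then r ⟨v, h⟩ else s (rev ⟨v, h⟩)
  have hlt (a : T.A₂) (ha : src a < tgt a) :
      (ρ (tgt a)).1 * C a * ((ρ (src a))⁻¹ : On n).1 ∈ Delta n := by
    have hsrc : ρ (src a) = r a := (dif_neg a.2).trans (if_pos ha)
    have htgt : ρ (tgt a) = s a := by
      refine (dif_neg (rev a).2).trans ((if_neg ?_).trans (congrArg s (rev_rev a)))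
      rw [show T.opp (tgt a) = src a from tgt_rev a]
      exact ha.not_gt
    rw [hsrc, htgt]
    exact hsr a
  refine ⟨ρ, fun a => (lt_or_gt_of_ne (Ne.symm a.2)).elim (hlt a) fun ha => ?_⟩
  obtain ⟨d, hd, hmono, h⟩ := hlt (rev a) (by rwa [tgt_rev])
  refine ⟨d, hd, hmono, ?_⟩
  rw [← Matrix.diagonal_transpose, ← h, tgt_rev, src_rev, hrev]
  simp only [On.coe_inv, Matrix.transpose_mul, Matrix.transpose_transpose, Matrix.mul_assoc]

theorem IsStandard.exists_smul_edge_mem_Delta (hF : F.IsStandard) :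
    ∃ ψ : V → Sp n, (ψ • F).IsStandard ∧ ∀ a, ((ψ • F).edge a).1.toBlocks₂₁ ∈ Delta n := by
  obtain ⟨r, hr⟩ := exists_orthogonal_edge_mem_Delta
    (fun a => isUnit_toBlocks₂₁ (hF.edge_smul_spanE a)) F.toBlocks₂₁_edge_rev
  refine ⟨fun v => orthSp n (r v), hF.smul_iff.2 fun v => ⟨r v, rfl⟩, fun a => ?_⟩
  rw [smul_edge, ← map_inv, toBlocks₂₁_orthSp_mul_mul_orthSp]
  exact hr a

theorem IsStandard.exists_holSystem_eq (hF : F.IsStandard)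
    (hΔ : ∀ a, (F.edge a).1.toBlocks₂₁ ∈ Delta n) :
    ∃ x : XPlusDelta T n, holSystem T x.1 = F := by
  choose u hu using hF.exists_tri_eq
  have hrev (a : T.A₂) : (F.edge (rev a)).1.toBlocks₂₁ = (F.edge a).1.toBlocks₂₁ := by
    rw [F.toBlocks₂₁_edge_rev, (mem_Delta_iff.1 (hΔ a)).1.isSymm]
  have hmul (v : V) : u (T.next (T.next v)) * u (T.next v) * u v = 1 := by
    have h := congrArg Matrix.toBlocks₁₁ (F.tri_twisted v)
    rw [hu, hu, hu, ← Matrix.fromBlocks_one, Matrix.fromBlocks_neg] at h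
    simpa [triMatrix, Matrix.fromBlocks_multiply, Subtype.ext_iff] using h
  let x : XPlusDelta T n :=
    ⟨⟨(fun a => (F.edge a).1.toBlocks₂₁ * (F.edge a).1.toBlocks₂₁, u),
      fun a => posDef_of_mem_Delta (mul_self_mem_Delta (hΔ a)), fun a => by simp only [hrev], hmul⟩,
      fun a => mul_self_mem_Delta (hΔ a)⟩
  exact ⟨x, ((isStandard_holSystem x.1).eq_iff hF).2
    ⟨fun a => sqrt_mul_self_of_mem_Delta (hΔ a), fun v => (hu v).symm⟩⟩

theorem exists_holDelta_eq (hF : F.IsMaximal) : ∃ x : XPlusDelta T n, holDelta T n x = ⟦F⟧ := by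
  obtain ⟨ψ, hψ⟩ := exists_isStandard_smul (isMaximal_iff.1 hF)
  obtain ⟨φ, hφ, hΔ⟩ := hψ.exists_smul_edge_mem_Delta
  obtain ⟨x, hx⟩ := hφ.exists_holSystem_eq hΔ
  refine ⟨x, ?_⟩
  rw [← mk_smul ψ F, ← mk_smul φ, ← hx]
  rfl

end FramedLocalSystem

theorem holDelta_mem_maximalModuli (x : XPlusDelta T n) : holDelta T n x ∈ maximalModuli T n :=
  FramedLocalSystem.mk_mem_maximalModuli_iff.2 (FramedLocalSystem.isMaximal_iff.2
    (FramedLocalSystem.isStandard_holSystem x.1).isPositiveAt)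

theorem surjective_holDeltaMax (h : ∀ x : XPlusDelta T n, holDelta T n x ∈ maximalModuli T n) :
    Function.Surjective (holDeltaMax T n h) := by
  rintro ⟨_, F, hF, rfl⟩
  obtain ⟨x, hx⟩ := FramedLocalSystem.exists_holDelta_eq hF
  exact ⟨x, Subtype.ext hx⟩

end Standard

/-! ### Fibres of the holonomy map -/

section Fibres

variable {n : ℕ}

theorem eq_of_monotone_of_forall_ne_zero {α R : Type*} [LinearOrder α] [CommRing R]
    {d d' : Fin n → α} (hd : Monotone d) (hd' : Monotone d') {r : Matrix (Fin n) (Fin n) R}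
    (hr : r.det ≠ 0) (h : ∀ i j, r i j ≠ 0 → d' i = d j) : d' = d := by
  rw [Matrix.det_apply] at hr
  obtain ⟨σ, -, hσ⟩ := Finset.exists_ne_zero_of_sum_ne_zero hr
  have hσ (i : Fin n) : d' (σ i) = d i := h _ _ fun h0 =>
    hσ (by rw [Finset.prod_eq_zero (f := fun i => r (σ i) i) (Finset.mem_univ i) h0, smul_zero])
  rw [← funext hσ] at hd
  exact (Tuple.unique_monotone (τ := 1) hd hd').symm.trans (funext hσ)

theorem eq_of_mul_eq_mul_of_mem_Delta {S S' r : Matrix (Fin n) (Fin n) ℝ} (hS : S ∈ Delta n)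
    (hS' : S' ∈ Delta n) (hr : IsUnit r) (h : S' * r = r * S) : S' = S := by
  obtain ⟨d, -, hd, rfl⟩ := hS
  obtain ⟨d', -, hd', rfl⟩ := hS'
  refine congrArg Matrix.diagonal (eq_of_monotone_of_forall_ne_zero hd hd'
    ((Matrix.isUnit_iff_isUnit_det _).1 hr).ne_zero fun i j hij => ?_)
  have hentry := congrFun₂ h i j
  rw [Matrix.diagonal_mul, Matrix.mul_diagonal, mul_comm] at hentry
  exact mul_left_cancel₀ hij hentry

theorem On.isUnit_coe (r : On n) : IsUnit r.1 := IsUnit.of_mul_eq_one _ r.coe_mul_coe_inv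

/-- Uniqueness of the singular value decomposition. -/
theorem mul_sqrt_mul_inv_eq_sqrt_iff {S S' : Matrix (Fin n) (Fin n) ℝ} (hS : S ∈ Delta n)
    (hS' : S' ∈ Delta n) {r r' : On n} :
    r'.1 * CFC.sqrt S * (r⁻¹ : On n).1 = CFC.sqrt S' ↔ S = S' ∧ r = r' ∧ Commute r.1 S := by
  have hcomm (h : Commute r.1 S) : Commute (CFC.sqrt S) r.1 := (h.symm).cfcₙ_nnreal _
  constructor
  · intro h
    replace h : CFC.sqrt S' * r.1 = r'.1 * CFC.sqrt S := by
      rw [← h, Matrix.mul_assoc, r.coe_inv_mul_coe, Matrix.mul_one]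
    have hflip : CFC.sqrt S' * r'.1 = r.1 * CFC.sqrt S := by
      have ht := congrArg Matrix.transpose h
      rw [Matrix.transpose_mul, Matrix.transpose_mul, sqrt_transpose, sqrt_transpose] at ht
      rw [← On.coe_inv, ← On.coe_inv] at ht
      rw [← one_mul (CFC.sqrt S'), ← r.coe_mul_coe_inv, Matrix.mul_assoc r.1, ht, Matrix.mul_assoc,
        Matrix.mul_assoc, r'.coe_inv_mul_coe, Matrix.mul_one]
    have hmul : S' * r.1 = r.1 * S := by
      rw [← sqrt_mul_sqrt (posDef_of_mem_Delta hS'), ← sqrt_mul_sqrt (posDef_of_mem_Delta hS),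
        Matrix.mul_assoc, h, ← Matrix.mul_assoc, hflip, Matrix.mul_assoc]
    obtain rfl := eq_of_mul_eq_mul_of_mem_Delta hS hS' r.isUnit_coe hmul
    refine ⟨rfl, Subtype.ext ?_, hmul.symm⟩
    have hunit := posDef_of_mem_Delta (sqrt_mem_Delta hS)
    exact hunit.isUnit.mul_right_cancel ((hcomm hmul.symm).eq.symm.trans h)
  · rintro ⟨rfl, rfl, h⟩
    rw [← (hcomm h).eq, Matrix.mul_assoc, r.coe_mul_coe_inv, Matrix.mul_one]

open FramedLocalSystem in
theorem orthSp_smul_holSystem_eq_iff {V : Type*} {T : IdealTriangulation V} (x x' : XPlusDelta T n)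
    (r : V → On n) :
    (fun v => orthSp n (r v)) • holSystem T x.1 = holSystem T x'.1 ↔
      (∀ a : T.A₂, x.1.1.1 a = x'.1.1.1 a ∧ r (src a) = r (tgt a) ∧
        Commute (r (src a)).1 (x.1.1.1 a)) ∧
      ∀ v, x'.1.1.2 v = r (T.next v) * x.1.1.2 v * (r v)⁻¹ := by
  have hx := isStandard_holSystem x.1
  rw [(hx.smul_iff.2 fun v => ⟨r v, rfl⟩).eq_iff (isStandard_holSystem x'.1)]
  refine and_congr (forall_congr' fun a => ?_) (forall_congr' fun v => ?_)
  · rw [smul_edge, ← map_inv, toBlocks₂₁_orthSp_mul_mul_orthSp]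
    exact mul_sqrt_mul_inv_eq_sqrt_iff (x.2 a) (x'.2 a)
  · rw [smul_tri, ← map_inv]
    exact (congrArg (· = _) (orthSp_mul_triMatrix_mul_orthSp _ _ _)).to_iff.trans
      (triMatrix_injective.eq_iff.trans eq_comm)

theorem holDelta_eq_iff {V : Type*} {T : IdealTriangulation V} (x x' : XPlusDelta T n) :
    holDelta T n x = holDelta T n x' ↔
      (∀ a : T.A₂, x.1.1.1 a = x'.1.1.1 a) ∧
      ∃ r : V → On n,
        (∀ a : T.A₂, r (src a) = r (tgt a) ∧
          Commute (r (src a) : Matrix (Fin n) (Fin n) ℝ) (x.1.1.1 a)) ∧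
        ∀ v : V, x'.1.1.2 v = r (T.next v) * x.1.1.2 v * (r v)⁻¹ := by
  have hx := FramedLocalSystem.isStandard_holSystem x.1
  have hx' := FramedLocalSystem.isStandard_holSystem x'.1
  refine FramedLocalSystem.mk_eq_mk_iff.trans ⟨?_, ?_⟩
  · rintro ⟨ψ, hψ⟩
    choose r hr using hx.smul_iff.1 (hψ ▸ hx')
    obtain rfl : (fun v => orthSp n (r v)) = ψ := funext hr
    obtain ⟨hedge, htri⟩ := (orthSp_smul_holSystem_eq_iff x x' r).1 hψ
    exact ⟨fun a => (hedge a).1, r, fun a => (hedge a).2, htri⟩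
  · rintro ⟨heq, r, hr, htri⟩
    exact ⟨_, (orthSp_smul_holSystem_eq_iff x x' r).2 ⟨fun a => ⟨heq a, hr a⟩, htri⟩⟩

end Fibres

/-! ### Properness -/

section Properness

open Filter Topology
open scoped Pointwise

variable {V : Type*} {T : IdealTriangulation V} {n : ℕ}

theorem isProperMap_of_isQuotientMap {W X Y Z : Type*} [TopologicalSpace W] [TopologicalSpace X]
    [TopologicalSpace Y] [TopologicalSpace Z] {π : X → Y} {α : W → X} {p : W → Z} {f : Z → Y}
    (hπ : IsQuotientMap π) (hα : IsProperMap α) (hp : Continuous p) (hf : Continuous f)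
    (hcomm : ∀ w, π (α w) = f (p w)) (hlift : ∀ z x, f z = π x → ∃ w, p w = z ∧ α w = x) :
    IsProperMap f := by
  refine isProperMap_iff_isClosedMap_and_compact_fibers.2 ⟨hf, fun C hC => ?_, fun y => ?_⟩
  · have hpre : π ⁻¹' (f '' C) = α '' (p ⁻¹' C) := by
      ext x
      constructor
      · rintro ⟨z, hz, hzx⟩
        obtain ⟨w, rfl, hw⟩ := hlift z x hzx
        exact ⟨w, hz, hw⟩
      · rintro ⟨w, hw, rfl⟩
        exact ⟨p w, hw, (hcomm w).symm⟩
    rw [← hπ.isClosed_preimage, hpre]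
    exact hα.isClosedMap _ (hC.preimage hp)
  · obtain ⟨x, rfl⟩ := hπ.surjective y
    have hfib : f ⁻¹' {π x} = p '' (α ⁻¹' {x}) := by
      ext z
      constructor
      · intro hz
        obtain ⟨w, hw, hwx⟩ := hlift z x hz
        exact ⟨w, hwx, hw⟩
      · rintro ⟨w, rfl, rfl⟩
        exact (hcomm w).symm
    rw [hfib]
    exact (hα.isCompact_preimage isCompact_singleton).image hp

theorem mem_Delta_iff_mem_closure {D : Matrix (Fin n) (Fin n) ℝ} (hD : IsUnit D) :
    D ∈ Delta n ↔ D ∈ closure (Delta n) := by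
  refine ⟨fun h => subset_closure h, fun h => ?_⟩
  have hclosed : IsClosed {D : Matrix (Fin n) (Fin n) ℝ |
      (∀ i j, i ≠ j → D i j = 0) ∧ (∀ i, 0 ≤ D i i) ∧ ∀ i j, i ≤ j → D i i ≤ D j j} := by
    simp only [Set.ofPred_and, Set.ofPred_forall]
    refine ((isClosed_iInter fun i => isClosed_iInter fun j => isClosed_iInter fun _ => ?_).inter
      ((isClosed_iInter fun i => ?_).inter
      (isClosed_iInter fun i => isClosed_iInter fun j => isClosed_iInter fun _ => ?_)))
    · exact isClosed_eq (by fun_prop) continuous_const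
    · exact isClosed_le continuous_const (by fun_prop)
    · exact isClosed_le (by fun_prop) (by fun_prop)
  obtain ⟨hdiag, hnonneg, hmono⟩ := closure_minimal (fun D hD => by
    obtain ⟨hdiag, hpos, hmono⟩ := mem_Delta_iff.1 hD
    exact ⟨fun i j => @hdiag i j, fun i => (hpos i).le, fun i j => @hmono i j⟩) hclosed h
  have hIsDiag : D.IsDiag := fun i j => hdiag i j
  refine mem_Delta_iff.2 ⟨hIsDiag, fun i => (hnonneg i).lt_of_ne' ?_, fun i j => hmono i j⟩
  rw [← hIsDiag.diagonal_diag, Matrix.isUnit_diagonal, Pi.isUnit_iff] at hD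
  exact (hD i).ne_zero

theorem continuous_holSystem : Continuous fun x : XPlusDelta T n => holSystem T x.1 := by
  have hx (x : XPlusDelta T n) (a : T.A₂) : CFC.sqrt (x.1.1.1 a) =
      Matrix.diagonal fun i => √(x.1.1.1 a i i) := by
    obtain ⟨hdiag, hpos, -⟩ := mem_Delta_iff.1 (x.2 a)
    conv_lhs => rw [← hdiag.diagonal_diag]
    exact sqrt_diagonal fun i => (hpos i).le
  have hsqrt (a : T.A₂) : Continuous fun x : XPlusDelta T n => CFC.sqrt (x.1.1.1 a) := by
    simp only [hx]
    fun_prop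
  have hinv (a : T.A₂) : Continuous fun x : XPlusDelta T n => (CFC.sqrt (x.1.1.1 a))⁻¹ := by
    refine continuous_iff_continuousAt.2 fun x => ?_
    obtain ⟨u, hu⟩ := sqrt_isUnit_det (x.1.2.1 a)
    exact (continuousAt_matrix_inv _ (hu ▸ NormedRing.inverse_continuousAt u)).comp
      (f := fun x : XPlusDelta T n => CFC.sqrt (x.1.1.1 a)) (hsqrt a).continuousAt
  refine FramedLocalSystem.continuous_iff.2 ⟨fun a => continuous_induced_rng.2 ?_,
    fun v => continuous_induced_rng.2 ?_, fun _ => continuous_const, fun _ => continuous_const⟩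
  · exact continuous_const.matrix_fromBlocks (hinv a).neg (hsqrt a) continuous_const
  · have hu : Continuous fun x : XPlusDelta T n => (x.1.1.2 v).1 := by fun_prop
    exact hu.matrix_fromBlocks hu.neg hu continuous_const

namespace FramedLocalSystem

theorem range_holSystem : Set.range (fun x : XPlusDelta T n => holSystem T x.1) =
    {F | F.IsStandard ∧ ∀ a, (F.edge a).1.toBlocks₂₁ ∈ closure (Delta n)} := by
  ext F
  constructor
  · rintro ⟨x, rfl⟩
    exact ⟨isStandard_holSystem x.1, fun a => subset_closure (sqrt_mem_Delta (x.2 a))⟩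
  · rintro ⟨hF, hΔ⟩
    exact hF.exists_holSystem_eq fun a =>
      (mem_Delta_iff_mem_closure (isUnit_toBlocks₂₁ (hF.edge_smul_spanE a))).2 (hΔ a)

theorem isClosed_setOf_isStandard : IsClosed {F : FramedLocalSystem T n | F.IsStandard} := by
  have h : {F : FramedLocalSystem T n | F.IsStandard} = {F | (∀ v, F.Lt v = spanE n) ∧
      (∀ v, F.Lb v = spanF n) ∧ ∀ v, F.tri v • spanE n = spanD n} :=
    Set.ext fun F => ⟨fun ⟨h₁, h₂, h₃⟩ => ⟨h₁, h₂, h₃⟩, fun ⟨h₁, h₂, h₃⟩ => ⟨h₁, h₂, h₃⟩⟩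
  simp only [h, Set.ofPred_and, Set.ofPred_forall]
  refine (isClosed_iInter fun v => ?_).inter
    ((isClosed_iInter fun v => ?_).inter (isClosed_iInter fun v => ?_)) <;>
    exact isClosed_eq (by fun_prop) continuous_const

theorem isClosedEmbedding_holSystem :
    IsClosedEmbedding fun x : XPlusDelta T n => holSystem T x.1 := by
  have hedge (a : T.A₂) :
      Continuous fun F : FramedLocalSystem T n => (F.edge a).1.toBlocks₂₁ :=
    (continuous_subtype_val.comp (continuous_edge a)).matrix_submatrix _ _
  let κ (F : FramedLocalSystem T n) :
      (T.A₂ → Matrix (Fin n) (Fin n) ℝ) × (V → Matrix (Fin n) (Fin n) ℝ) :=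
    (fun a => (F.edge a).1.toBlocks₂₁ * (F.edge a).1.toBlocks₂₁, fun v => (F.tri v).1.toBlocks₁₁)
  have hκ : Continuous κ := by
    refine (continuous_pi fun a => (hedge a).mul (hedge a)).prodMk (continuous_pi fun v => ?_)
    exact (continuous_subtype_val.comp (continuous_tri v)).matrix_submatrix _ _
  have hcomp : κ ∘ (fun x : XPlusDelta T n => holSystem T x.1) =
      Prod.map id (Pi.map fun _ => Subtype.val) ∘ Subtype.val ∘ Subtype.val :=
    funext fun x => Prod.ext (funext fun a => sqrt_mul_sqrt (x.1.2.1 a)) rfl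
  refine ⟨IsEmbedding.of_comp continuous_holSystem hκ ?_, ?_⟩
  · rw [hcomp]
    exact (IsEmbedding.id.prodMap (IsEmbedding.piMap fun _ => .subtypeVal)).comp
      (IsEmbedding.subtypeVal.comp .subtypeVal)
  · rw [range_holSystem, Set.ofPred_and, Set.ofPred_forall]
    exact isClosed_setOf_isStandard.inter
      (isClosed_iInter fun a => isClosed_closure.preimage (hedge a))

end FramedLocalSystem

theorem PosTriple.exists_isCompact_eventually_mem {L₁ M L₂ : Lag n} (h : PosTriple L₁ M L₂) :
    ∃ K : Set (Sp n), IsCompact K ∧ ∀ᶠ p in 𝓝 (L₁, M, L₂), ∀ g : Sp n,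
      g • (spanE n, spanD n, spanF n) = p → g ∈ K := by
  obtain ⟨k, rfl, rfl, rfl⟩ := h.exists_sp
  obtain ⟨K, hK, hmem⟩ := exists_isCompact_eventually_mem_of_smul_eq n
  refine ⟨k • K, hK.smul k, ?_⟩
  have hlim := (continuous_const_smul k⁻¹).tendsto (k • (spanE n, spanD n, spanF n))
  rw [inv_smul_smul] at hlim
  filter_upwards [hlim.eventually hmem] with p hp g hg
  exact Set.mem_smul_set_iff_inv_smul_mem.2 (hp _ (by rw [← hg]; exact mul_smul _ _ _))

namespace FramedLocalSystem

/-- The gauge transformations are controlled by their action on the Lagrangians at the vertices of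
the faces. -/
theorem exists_smul_holSystem_eq_of_tendsto {𝒰 : Ultrafilter ((V → Sp n) × XPlusDelta T n)}
    {F : FramedLocalSystem T n} (hF : F.IsMaximal)
    (h : Tendsto (fun w : (V → Sp n) × XPlusDelta T n => w.1 • holSystem T w.2.1) 𝒰 (𝓝 F)) :
    ∃ w : (V → Sp n) × XPlusDelta T n, w.1 • holSystem T w.2.1 = F ∧ 𝒰 ≤ 𝓝 w := by
  have hconv (v : V) :
      ∃ g : Sp n, Tendsto (fun w : (V → Sp n) × XPlusDelta T n => w.1 v) 𝒰 (𝓝 g) := by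
    set u := T.next (T.next v)
    have hnext : T.next u = v := T.next_next_next v
    obtain ⟨K, hK, hmem⟩ := (isMaximal_iff.1 hF u).exists_isCompact_eventually_mem
    have htriple : Continuous fun G : FramedLocalSystem T n =>
        (G.Lt (T.next u), G.tri u • G.Lt u, G.Lb (T.next u)) := by fun_prop
    have hK𝒰 : ∀ᶠ w in 𝒰.1, w.1 v ∈ K := by
      filter_upwards [((htriple.tendsto F).comp h).eventually hmem] with w hw
      refine hw _ ?_
      simp only [Function.comp_apply, smul_Lt, smul_Lb, smul_tri, hnext, mul_smul, inv_smul_smul]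
      exact congrArg (fun M => (w.1 v • spanE n, w.1 v • M, w.1 v • spanF n))
        (triMatrix_smul_spanE _).symm
    obtain ⟨g, -, hg⟩ := hK.ultrafilter_le_nhds
      (𝒰.map fun w : (V → Sp n) × XPlusDelta T n => w.1 v) (le_principal_iff.2 hK𝒰)
    exact ⟨g, hg⟩
  choose ψ hψ using hconv
  have hψ : Tendsto Prod.fst 𝒰.1 (𝓝 ψ) := tendsto_pi_nhds.2 hψ
  have hhol : Tendsto (fun w => holSystem T w.2.1) 𝒰.1 (𝓝 (ψ⁻¹ • F)) :=
    (hψ.inv.smul h).congr fun w => inv_smul_smul _ _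
  obtain ⟨x, hx, hlim⟩ := isClosedEmbedding_holSystem.isProperMap.ultrafilter_le_nhds_of_tendsto
    (𝒰 := 𝒰.map Prod.snd) hhol
  refine ⟨(ψ, x), ?_, ?_⟩
  · rw [hx, smul_inv_smul]
  · rw [nhds_prod_eq]
    exact hψ.prodMk hlim

end FramedLocalSystem

theorem isProperMap_holDeltaMax (h : ∀ x : XPlusDelta T n, holDelta T n x ∈ maximalModuli T n) :
    IsProperMap (holDeltaMax T n h) := by
  let mk (F : FramedLocalSystem T n) : Moduli T n := ⟦F⟧
  have hmk : IsOpenQuotientMap mk := FramedLocalSystem.isOpenQuotientMap_mk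
  let α (w : (V → Sp n) × XPlusDelta T n) : mk ⁻¹' maximalModuli T n :=
    ⟨w.1 • holSystem T w.2.1, by
      rw [Set.mem_preimage, show mk _ = _ from FramedLocalSystem.mk_smul _ _]; exact h w.2⟩
  have hα : IsProperMap α := by
    refine isProperMap_iff_ultrafilter.2 ⟨?_, fun 𝒰 F hF => ?_⟩
    · exact (continuous_fst.smul (continuous_holSystem.comp continuous_snd)).subtype_mk _
    · obtain ⟨w, hw, hlim⟩ := FramedLocalSystem.exists_smul_holSystem_eq_of_tendsto
        (FramedLocalSystem.mk_mem_maximalModuli_iff.1 F.2)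
        ((continuous_subtype_val.tendsto F).comp hF)
      exact ⟨w, Subtype.ext hw, hlim⟩
  have hhol : Continuous (holDeltaMax T n h) :=
    (hmk.continuous.comp continuous_holSystem).codRestrict h
  refine isProperMap_of_isQuotientMap (hmk.restrictPreimage (maximalModuli T n)).isQuotientMap hα
    continuous_snd hhol (fun w => Subtype.ext (FramedLocalSystem.mk_smul _ _)) fun x F hxF => ?_
  obtain ⟨ψ, hψ⟩ := FramedLocalSystem.mk_eq_mk_iff.1 (congrArg Subtype.val hxF)
  exact ⟨(ψ, x), rfl, Subtype.ext hψ⟩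

end Properness

/-! ### Generic finiteness -/

section GenericFiniteness

open Filter Topology

theorem genericallyFiniteToOne_of_isClosedMap {X Y : Type*} [TopologicalSpace X]
    [TopologicalSpace Y] {f : X → Y} (hf : IsClosedMap f) (hcont : Continuous f)
    (hsurj : Function.Surjective f) {s : Set X} (hopen : IsOpen s) (hdense : Dense s)
    (hsat : ∀ x ∈ s, ∀ x', f x' = f x → x' ∈ s) (hfin : ∀ x ∈ s, (f ⁻¹' {f x}).Finite) :
    GenericallyFiniteToOne f := by
  have hpre : f ⁻¹' (f '' s) = s :=
    Set.Subset.antisymm (fun x' ⟨x, hx, hxx'⟩ => hsat x hx x' hxx'.symm)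
      (Set.subset_preimage_image f s)
  refine ⟨f '' s, ?_, hsurj.denseRange.dense_image hcont hdense, hpre.symm ▸ hdense, ?_⟩
  · rwa [← (hf.isQuotientMap hcont hsurj).isOpen_preimage, hpre]
  · rintro _ ⟨x, hx, rfl⟩
    exact hfin x hx

variable {V : Type*} {T : IdealTriangulation V} {n : ℕ}

/-- The coordinates whose diagonal matrices have simple spectrum, so that only diagonal matrices
commute with them. -/
def simpleSpectrum (T : IdealTriangulation V) (n : ℕ) : Set (XPlusDelta T n) :=
  {x | ∀ a, Function.Injective (x.1.1.1 a).diag}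

theorem isOpen_simpleSpectrum [Finite V] : IsOpen (simpleSpectrum T n) := by
  simp only [simpleSpectrum, Function.injective_iff_pairwise_ne, Pairwise, Set.ofPred_forall]
  refine isOpen_iInter_of_finite fun a => isOpen_iInter_of_finite fun i =>
    isOpen_iInter_of_finite fun j => isOpen_iInter_of_finite fun _ => ?_
  have hentry (i : Fin n) : Continuous fun x : XPlusDelta T n => (x.1.1.1 a).diag i :=
    Continuous.matrix_elem (by fun_prop) i i
  exact isOpen_ne_fun (hentry i) (hentry j)

/-- The perturbation `x + t • diag(0, …, n - 1)` of the coordinates on the internal edges, which has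
simple spectrum for `t > 0`. -/
def spread (x : XPlusDelta T n) (t : Set.Ici (0 : ℝ)) : XPlusDelta T n :=
  have hpos (a : T.A₂) (i : Fin n) : 0 < x.1.1.1 a i i + t.1 * i :=
    add_pos_of_pos_of_nonneg ((mem_Delta_iff.1 (x.2 a)).2.1 i) (mul_nonneg t.2 (Nat.cast_nonneg _))
  ⟨⟨(fun a => Matrix.diagonal fun i => x.1.1.1 a i i + t.1 * i, x.1.1.2),
    fun a => Matrix.posDef_diagonal_iff.2 (hpos a), fun a => by simp only [x.1.2.2.1 a],
    x.1.2.2.2⟩,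
    fun a => ⟨_, hpos a, fun _ _ hij => add_le_add ((mem_Delta_iff.1 (x.2 a)).2.2 hij)
      (mul_le_mul_of_nonneg_left (Nat.cast_le.2 hij) t.2), rfl⟩⟩

theorem spread_zero (x : XPlusDelta T n) : spread x ⟨0, Set.self_mem_Ici⟩ = x := by
  refine Subtype.ext (Subtype.ext (Prod.ext (funext fun a => ?_) rfl))
  simp only [spread, zero_mul, add_zero]
  exact (mem_Delta_iff.1 (x.2 a)).1.diagonal_diag

theorem continuous_spread (x : XPlusDelta T n) : Continuous (spread x) := by
  refine continuous_induced_rng.2 (continuous_induced_rng.2 (.prodMk ?_ continuous_const))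
  exact continuous_pi fun a => Continuous.matrix_diagonal (by fun_prop)

theorem spread_mem_simpleSpectrum (x : XPlusDelta T n) {t : Set.Ici (0 : ℝ)} (ht : 0 < t.1) :
    spread x t ∈ simpleSpectrum T n := by
  intro a
  have hmono : StrictMono fun i : Fin n => x.1.1.1 a i i + t.1 * (i : ℕ) := fun i j hij =>
    add_lt_add_of_le_of_lt ((mem_Delta_iff.1 (x.2 a)).2.2 hij.le)
      (mul_lt_mul_of_pos_left (Nat.cast_lt.2 hij) ht)
  simpa only [spread, Matrix.diag_diagonal] using hmono.injective

theorem dense_simpleSpectrum : Dense (simpleSpectrum T n) := by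
  intro x
  let t (k : ℕ) : Set.Ici (0 : ℝ) := ⟨1 / ((k : ℝ) + 1),
    Set.mem_Ici.2 Nat.one_div_pos_of_nat.le⟩
  have ht : Tendsto t atTop (𝓝 ⟨0, Set.self_mem_Ici⟩) :=
    tendsto_subtype_rng.2 tendsto_one_div_add_atTop_nhds_zero_nat
  have h := ((continuous_spread x).tendsto _).comp ht
  rw [spread_zero] at h
  exact mem_closure_of_tendsto h (Eventually.of_forall fun k =>
    spread_mem_simpleSpectrum x Nat.one_div_pos_of_nat)

theorem isDiag_of_commute_diagonal {m R : Type*} [Fintype m] [DecidableEq m] [CommRing R]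
    [IsDomain R] {d : m → R} (hd : Function.Injective d) {A : Matrix m m R}
    (h : Commute A (Matrix.diagonal d)) : A.IsDiag := fun i j hij => by
  have hentry : (A * Matrix.diagonal d) i j = (Matrix.diagonal d * A) i j := by rw [h.eq]
  rw [Matrix.mul_diagonal, Matrix.diagonal_mul, mul_comm] at hentry
  by_contra hA
  exact hij (hd (mul_right_cancel₀ hA hentry)).symm

theorem finite_setOf_isDiag_orthogonal (n : ℕ) : {r : On n | r.1.IsDiag}.Finite := by
  have hfin : (Set.univ.pi fun _ : Fin n => ({1, -1} : Set ℝ)).Finite :=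
    Set.Finite.pi fun _ => Set.toFinite _
  refine Set.Finite.of_finite_image (f := fun r : On n => r.1.diag) (hfin.subset ?_) ?_
  · rintro _ ⟨r, hr, rfl⟩ i -
    have h := congrFun₂ r.coe_mul_coe_inv i i
    rw [On.coe_inv, hr.isSymm, ← hr.diagonal_diag, Matrix.diagonal_mul_diagonal,
      Matrix.diagonal_apply_eq, Matrix.one_apply_eq] at h
    exact mul_self_eq_one_iff.1 h
  · intro r hr s hs hrs
    exact Subtype.ext (hr.diagonal_diag.symm.trans
      ((congrArg Matrix.diagonal hrs).trans hs.diagonal_diag))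

theorem finite_setOf_holDelta_eq [Finite V] (hT : ∀ v, T.opp v ≠ v) {x : XPlusDelta T n}
    (hx : x ∈ simpleSpectrum T n) : {x' | holDelta T n x = holDelta T n x'}.Finite := by
  have hfin : {r : V → On n | ∀ v, (r v).1.IsDiag}.Finite :=
    Set.Finite.pi' fun _ => finite_setOf_isDiag_orthogonal n
  refine Set.Finite.of_finite_image (f := fun x' => x'.1.1)
    ((hfin.image fun r => (x.1.1.1, fun v => r (T.next v) * x.1.1.2 v * (r v)⁻¹)).subset ?_)
    (fun x' _ x'' _ h => Subtype.ext (Subtype.ext h))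
  rintro _ ⟨x', hx', rfl⟩
  obtain ⟨hedge, r, hr, htri⟩ := (holDelta_eq_iff x x').1 hx'
  refine ⟨r, fun v => ?_, Prod.ext (funext hedge) (funext fun v => (htri v).symm)⟩
  have hcomm := (hr ⟨v, hT v⟩).2
  rw [← (mem_Delta_iff.1 (x.2 ⟨v, hT v⟩)).1.diagonal_diag] at hcomm
  exact isDiag_of_commute_diagonal (hx ⟨v, hT v⟩) hcomm

theorem genericallyFiniteToOne_holDeltaMax [Finite V] (hT : ∀ v, T.opp v ≠ v)
    (h : ∀ x : XPlusDelta T n, holDelta T n x ∈ maximalModuli T n) :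
    GenericallyFiniteToOne (holDeltaMax T n h) := by
  have hproper := isProperMap_holDeltaMax h
  refine genericallyFiniteToOne_of_isClosedMap hproper.isClosedMap hproper.continuous
    (surjective_holDeltaMax h) isOpen_simpleSpectrum dense_simpleSpectrum
    (fun x hx x' hxx' a => ?_) fun x hx => ?_
  · rw [((holDelta_eq_iff x' x).1 (congrArg Subtype.val hxx')).1 a]
    exact hx a
  · exact (finite_setOf_holDelta_eq hT hx).subset fun x' hx' => (congrArg Subtype.val hx').symm

end GenericFiniteness

end FramedSp

end

theorem mainTheorem1_general {V : Type*} (T : IdealTriangulation V) (n : ℕ) :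
    ∃ h : ∀ x : XPlusDelta T n, holDelta T n x ∈ maximalModuli T n,
      Function.Surjective (holDeltaMax T n h) ∧
      (∀ x x' : XPlusDelta T n, holDeltaMax T n h x = holDeltaMax T n h x' ↔
        (∀ a : T.A₂, x.1.1.1 a = x'.1.1.1 a) ∧
        ∃ r : V → On n,
          (∀ a : T.A₂, r (src a) = r (tgt a) ∧
            Commute (r (src a) : Matrix (Fin n) (Fin n) ℝ) (x.1.1.1 a)) ∧
          ∀ v : V, x'.1.1.2 v = r (T.next v) * x.1.1.2 v * (r v)⁻¹) ∧
      IsProperMap (holDeltaMax T n h) ∧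
      (Finite V → (∀ v : V, T.opp v ≠ v) → GenericallyFiniteToOne (holDeltaMax T n h)) :=
  ⟨holDelta_mem_maximalModuli, surjective_holDeltaMax _,
    fun x x' => Subtype.ext_iff.trans (holDelta_eq_iff x x'),
    isProperMap_holDeltaMax _, fun _ hT => genericallyFiniteToOne_holDeltaMax hT _⟩

theorem mainTheorem1 {V : Type*} [Finite V] [Nonempty V] (T : IdealTriangulation V) (n : ℕ) :
    ∃ h : ∀ x : XPlusDelta T n, holDelta T n x ∈ maximalModuli T n,
      Function.Surjective (holDeltaMax T n h) ∧
      (∀ x x' : XPlusDelta T n, holDeltaMax T n h x = holDeltaMax T n h x' ↔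
        (∀ a : T.A₂, x.1.1.1 a = x'.1.1.1 a) ∧
        ∃ r : V → On n,
          (∀ a : T.A₂, r (src a) = r (tgt a) ∧
            Commute (r (src a) : Matrix (Fin n) (Fin n) ℝ) (x.1.1.1 a)) ∧
          ∀ v : V, x'.1.1.2 v = r (T.next v) * x.1.1.2 v * (r v)⁻¹) ∧
      IsProperMap (holDeltaMax T n h) ∧
      ((∀ v : V, T.opp v ≠ v) → GenericallyFiniteToOne (holDeltaMax T n h)) := by
  obtain ⟨h, hsurj, hfibre, hproper, hfinite⟩ := mainTheorem1_general T n
  exact ⟨h, hsurj, hfibre, hproper, hfinite inferInstance⟩
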